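/- Let $K$ be a field of characteristic $0$. Let $M(1)$ be the odd contact Lie superalgebra: the space of generating functions $f(x,T,X)$, formal power series in an even variable $x$ and odd (Grassmann) variables $T,X$, with the bracket $$\{f,g\}=\delta(f)\frac{\partial g}{\partial T}+(-1)^{p(f)}\frac{\partial f}{\partial T}\,\delta(g)-\Big(\frac{\partial f}{\partial x}\frac{\partial g}{\partial X}+(-1)^{p(f)}\frac{\partial f}{\partial X}\frac{\partial g}{\partial x}\Big),\qquad \delta(f)=2f-x\frac{\partial f}{\partial x}-X\frac{\partial f}{\partial X},$$ where derivatives in $T,X$ are left derivatives and $p(f)$ is the Grassmann parity of $f$. The even elements of the Lie superalgebra $M(1)$ are the Grassmann odd functions (spanned topologically by $x^iX$, $x^iT$), and its odd elements are the Grassmann even ones (spanned topologically by $x^iTX$, $x^i$). Let $C^k$ be the space of $k$-linear super skew-symmetric maps $M(1)^k\to K$ (symmetric under transposition of adjacent odd arguments, antisymmetric under all other transpositions of adjacent homogeneous arguments) that are continuous, i.e. vanish as soon as one argument is divisible by a sufficiently high power of $x$. Let $d:C^k\to C^{k+1}$ be the differential for the trivial module, given on homogeneous arguments of parities $s_0,\dots,s_k$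 by $$dC(v_0,\dots,v_k)=\sum_{i<j}(-1)^{\,j+s_j(s_{i+1}+\cdots+s_{j-1})}\,C(v_0,\dots,v_{i-1},[v_i,v_j],v_{i+1},\dots,\widehat{v_j},\dots,v_k),$$ where $[v_i,v_j]=\{v_i,v_j\}$, and let $Z^k=\ker d|_{C^k}$, $B^k=d(C^{k-1})$ (with $B^0=0$), $H^k(M(1))=Z^k/B^k$. Then in the degrees $1\le k\le 10$ there is exactly one basic non-trivial class, and it has degree $3$: 1. $H^k(M(1))=0$ for all $1\le k\le 10$ with $k\ne 3$. 2. $H^3(M(1))$ is one-dimensional, with coordinate $$a^3=C(T,TX,x)-\tfrac12\,C(T,xTX,1);$$ that is, the linear map $Z^3\to K$ that sends a cocycle $C$ to this combination of its values vanishes on $B^3$ and induces an isomorphism $H^3(M(1))\cong K$. 3. For every $C\in Z^3$, $$\begin{aligned}a^3&=C(X,xX,xT)-\tfrac12C(T,xTX,1)\\&=-C(X,T,xT)-\tfrac12C(T,xTX,1)\\&=C(X,xTX,x)+\tfrac12C(x^2X,TX,1)+\tfrac12C(xT,TX,1)\\&=-C(xX,TX,x)-\tfrac12C(T,xTX,1).\end{aligned}$$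 -/

import Mathlib

namespace OddContact

/-- The four monomials `1, T, X, TX` of the Grassmann algebra on the odd variables `T, X`. -/
inductive GMon
  | one
  | T
  | X
  | TX
  deriving DecidableEq

/-- Grassmann parity of a monomial. -/
def GMon.parity : GMon → ZMod 2
  | .one => 0
  | .T => 1
  | .X => 1
  | .TX => 0

/-- The space of generating functions in one even variable `x` and two odd variables `T, X`:
`f = f₁ + f_T T + f_X X + f_TX TX` with formal power series in `x` as coefficients. -/
abbrev M1 (K : Type*) [Field K] := GMon → PowerSeries K

section

variable {K : Type*} [Field K]

/-- The supercommutative product, with `T T = X X = 0` and `X T = - T X`. -/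
noncomputable def mul (f g : M1 K) : M1 K
  | .one => f .one * g .one
  | .T => f .one * g .T + f .T * g .one
  | .X => f .one * g .X + f .X * g .one
  | .TX => f .one * g .TX + f .TX * g .one + f .T * g .X - f .X * g .T

/-- `∂f/∂x`. -/
noncomputable def dx (f : M1 K) : M1 K := fun m => PowerSeries.derivative K (f m)

/-- The left derivative `∂f/∂T`. -/
def dT (f : M1 K) : M1 K
  | .one => f .T
  | .X => f .TX
  | .T => 0
  | .TX => 0

/-- The left derivative `∂f/∂X`; here `∂(TX)/∂X = -T`. -/
def dX (f : M1 K) : M1 K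
  | .one => f .X
  | .T => - f .TX
  | .X => 0
  | .TX => 0

/-- The linear extension of `f ↦ (-1)^{p(f)} f`, where `p(f)` is the Grassmann parity of the
generating function `f`. -/
def signed (f : M1 K) : M1 K
  | .one => f .one
  | .T => - f .T
  | .X => - f .X
  | .TX => f .TX

/-- The generating function `x^i m`, for a Grassmann monomial `m`. -/
noncomputable def mono (K : Type*) [Field K] (m : GMon) (i : ℕ) : M1 K :=
  Pi.single m (PowerSeries.X ^ i)

/-- `E = x ∂/∂x + X ∂/∂X`. -/
noncomputable def euler (f : M1 K) : M1 K :=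
  mul (mono K .one 1) (dx f) + mul (mono K .X 0) (dX f)

/-- `δ(f) = 2 f - E(f)`. -/
noncomputable def delta (f : M1 K) : M1 K := (2 : K) • f - euler f

/-- The Buttin bracket `∂f/∂x ∂g/∂X + (-1)^{p(f)} ∂f/∂X ∂g/∂x`. -/
noncomputable def buttin (f g : M1 K) : M1 K :=
  mul (dx f) (dX g) + mul (dX (signed f)) (dx g)

/-- The bracket of the odd contact superalgebra `M(1)`:
`{f,g} = δ(f) ∂g/∂T + (-1)^{p(f)} ∂f/∂T δ(g) - {f,g}_Buttin`. -/
noncomputable def bracket (f g : M1 K) : M1 K :=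
  mul (delta f) (dT g) + mul (dT (signed f)) (delta g) - buttin f g

/-- The component `M(1)_a`, `a ∈ ℤ/2`. The bracket is odd with respect to the Grassmann parity, so
the parity of the Lie superalgebra is the opposite one: `M(1)_0` consists of the Grassmann odd
generating functions and `M(1)_1` of the Grassmann even ones. -/
def part (K : Type*) [Field K] (a : ZMod 2) : Submodule K (M1 K) where
  carrier := {f | ∀ m : GMon, m.parity ≠ a + 1 → f m = 0}
  add_mem' := by
    intro f g hf hg m hm
    simp [hf m hm, hg m hm]
  zero_mem' := by
    intro m _
    rfl
  smul_mem' := by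
    intro r f hf m hm
    simp [hf m hm]

/-- Super skew-symmetry: the value does not change under the transposition of two adjacent odd
arguments, and changes sign under the transposition of two adjacent homogeneous arguments that
are not both odd. -/
def IsSuperSkew {k : ℕ} (c : MultilinearMap K (fun _ : Fin k => M1 K) K) : Prop :=
  ∀ (i j : Fin k), (j : ℕ) = i + 1 → ∀ (a b : ZMod 2) (v : Fin k → M1 K),
    v i ∈ part K a → v j ∈ part K b →
      c (v ∘ Equiv.swap i j) = - (-1) ^ (a.val * b.val) * c v

/-- Continuity for the `(x)`-adic topology on `M(1)` and the discrete topology on `K`: the value is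
zero as soon as one of the arguments is divisible by a sufficiently high power of `x`. -/
def IsAdicContinuous {k : ℕ} (c : MultilinearMap K (fun _ : Fin k => M1 K) K) : Prop :=
  ∃ N : ℕ, ∀ (v : Fin k → M1 K) (i : Fin k),
    (∀ m : GMon, (PowerSeries.X ^ N : PowerSeries K) ∣ v i m) → c v = 0

/-- The space `C^k(M(1); K)` of `k`-cochains with values in the trivial module. -/
def Cochain (K : Type*) [Field K] (k : ℕ) :
    Submodule K (MultilinearMap K (fun _ : Fin k => M1 K) K) where
  carrier := {c | IsSuperSkew c ∧ IsAdicContinuous c}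
  add_mem' := by
    rintro c c' ⟨h, N, hN⟩ ⟨h', N', hN'⟩
    refine ⟨fun i j hij a b v hi hj => ?_, max N N', fun v i hv => ?_⟩
    · simp only [add_apply, h i j hij a b v hi hj, h' i j hij a b v hi hj]
      ring
    · have e := hN v i fun m => (pow_dvd_pow _ (le_max_left N N')).trans (hv m)
      have e' := hN' v i fun m => (pow_dvd_pow _ (le_max_right N N')).trans (hv m)
      simp [e, e']
  zero_mem' := ⟨fun i j _ a b v _ _ => by simp, 0, fun v i _ => by simp⟩
  smul_mem' := by
    rintro r c ⟨h, N, hN⟩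
    refine ⟨fun i j hij a b v hi hj => ?_, N, fun v i hv => ?_⟩
    · simp only [smul_apply, h i j hij a b v hi hj, smul_eq_mul]
      ring
    · simp [hN v i hv]

/-- The value of `dc` at homogeneous arguments `v₀, …, v_k` of parities `s₀, …, s_k`:
`∑_{i<j} (-1)^{j + s_j (s_{i+1} + ⋯ + s_{j-1})} c(v₀, …, v_{i-1}, [v_i, v_j], …, v̂_j, …, v_k)`.
If the even arguments `e₀, …, e_q` precede the odd ones, the sign is `(-1)^j` for a bracket
`[e_i, e_j]`, `(-1)^{q+1}` for `[e_i, O_j]` and `(-1)^{i+1}` for `[O_i, O_j]`. -/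
noncomputable def dValue {k : ℕ} (c : MultilinearMap K (fun _ : Fin k => M1 K) K)
    (s : Fin (k + 1) → ZMod 2) (v : Fin (k + 1) → M1 K) : K :=
  ∑ i : Fin (k + 1), ∑ j ∈ Finset.Ioi i,
    (-1) ^ ((j : ℕ) + (s j).val * ∑ m ∈ Finset.Ioo i j, (s m).val) *
      c (j.removeNth (Function.update v i (bracket (v i) (v j))))

/-- `D = dc`: the two sides agree on all homogeneous arguments (which determines `D`). -/
def IsDifferential {k : ℕ} (c : MultilinearMap K (fun _ : Fin k => M1 K) K)
    (D : MultilinearMap K (fun _ : Fin (k + 1) => M1 K) K) : Prop :=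
  ∀ (s : Fin (k + 1) → ZMod 2) (v : Fin (k + 1) → M1 K),
    (∀ m, v m ∈ part K (s m)) → D v = dValue c s v

theorem dValue_add {k : ℕ} (c c' : MultilinearMap K (fun _ : Fin k => M1 K) K)
    (s : Fin (k + 1) → ZMod 2) (v : Fin (k + 1) → M1 K) :
    dValue (c + c') s v = dValue c s v + dValue c' s v := by
  simp only [dValue, add_apply, mul_add, Finset.sum_add_distrib]

theorem dValue_smul {k : ℕ} (r : K) (c : MultilinearMap K (fun _ : Fin k => M1 K) K)
    (s : Fin (k + 1) → ZMod 2) (v : Fin (k + 1) → M1 K) :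
    dValue (r • c) s v = r * dValue c s v := by
  simp only [dValue, smul_apply, smul_eq_mul, Finset.mul_sum, mul_left_comm]

theorem dValue_zero {k : ℕ} (s : Fin (k + 1) → ZMod 2) (v : Fin (k + 1) → M1 K) :
    dValue (0 : MultilinearMap K (fun _ : Fin k => M1 K) K) s v = 0 := by
  simp [dValue]

/-- The space `Z^k` of cocycles: `dc = 0`. -/
def Cocycle (K : Type*) [Field K] (k : ℕ) :
    Submodule K (MultilinearMap K (fun _ : Fin k => M1 K) K) where
  carrier := {c | c ∈ Cochain K k ∧ IsDifferential c 0}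
  add_mem' := by
    rintro c c' ⟨h, hd⟩ ⟨h', hd'⟩
    refine ⟨add_mem h h', fun s v hv => ?_⟩
    rw [dValue_add, ← hd s v hv, ← hd' s v hv]
    simp
  zero_mem' := ⟨zero_mem _, fun s v _ => by rw [dValue_zero]; rfl⟩
  smul_mem' := by
    rintro r c ⟨h, hd⟩
    refine ⟨Submodule.smul_mem _ r h, fun s v hv => ?_⟩
    rw [dValue_smul, ← hd s v hv]
    simp

/-- The space `B^k` of coboundaries: `c = db` for a `(k-1)`-cochain `b`; `B^0 = 0`. -/
def Coboundary (K : Type*) [Field K] :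
    (k : ℕ) → Submodule K (MultilinearMap K (fun _ : Fin k => M1 K) K)
  | 0 => ⊥
  | k + 1 =>
    { carrier := {c | c ∈ Cochain K (k + 1) ∧ ∃ b ∈ Cochain K k, IsDifferential b c}
      add_mem' := by
        rintro c c' ⟨h, b, hb, hd⟩ ⟨h', b', hb', hd'⟩
        refine ⟨add_mem h h', b + b', add_mem hb hb', fun s v hv => ?_⟩
        rw [dValue_add, add_apply, hd s v hv, hd' s v hv]
      zero_mem' := ⟨zero_mem _, 0, zero_mem _, fun s v _ => by rw [dValue_zero]; rfl⟩
      smul_mem' := by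
        rintro r c ⟨h, b, hb, hd⟩
        refine ⟨Submodule.smul_mem _ r h, r • b, Submodule.smul_mem _ r hb, fun s v hv => ?_⟩
        rw [dValue_smul, smul_apply, hd s v hv, smul_eq_mul] }

instance (K : Type*) [Field K] (k : ℕ) : AddCommGroup (Cocycle K k) :=
  Submodule.addCommGroup _

/-- The cohomology `H^k(M(1); K) = Z^k / B^k` with coefficients in the trivial module. -/
abbrev Cohomology (K : Type*) [Field K] (k : ℕ) :=
  Cocycle K k ⧸ (Coboundary K k).submoduleOf (Cocycle K k)

end

end OddContact

namespace OddContact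

/-! A continuous cochain is determined by its values on monomials, that is, by a function of words
in the letters `x^n m`, and every skew function of words that vanishes for large exponents arises in
this way. So the cohomology can be computed with words, where the differential is defined
recursively by Cartan's formula.

The even elements `xX` and `T` act diagonally with integer eigenvalues. By Cartan's homotopy formula
only words of degree zero for both gradings matter (`exists_invariant`).

Let `ξ` be the linear form dual to `X`. Among the other letters only the bracket of `TX` and `1`
produces `X`, so modulo `ξ` the form `dξ` is a nonzero multiple of the product of the forms dual to
`TX` and `1`. The differential ideal generated by `ξ` is then acyclic, as in a Weil algebra
(`exists_primitive`), and the computation takes place in the quotient by it.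

A word of degree zero that survives in the quotient consists of `xX`, `T` and equally many letters
of each kind from one of the pairs `(xTX, 1)`, `(TX, x)` (`letters_of_degree_zero`,
`IsRootPair.eq_zero`). Let `ε`, `η` be dual to `xX`, `T`, and let `u`, `v` be the products of the
forms dual to the two letters of each pair. The brackets `[xTX, 1] = 2xX` and `[TX, x] = xX + T`
give, up to normalisation, the complex `Λ(ε, η) ⊗ K[u, v]/(uv)` with `dε = -(2u + v)` and `dη = -v`.
Over `K[u, v]` this Koszul complex would be acyclic in positive degree; the relation `uv = 0`
creates exactly one class, `(η - ε)v`, whose differential is `2uv = 0`. It has degree three. The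
surjectivity of `a³` comes from a lift of this class (`exists_third_cocycle`), and everything else
is killed by `exists_primitive_even` and `exists_primitive_odd`. -/

/-- The basis `x^n m` of the polynomial part of `M(1)`, indexed by `(m, n)`. -/
abbrev Letter := GMon × ℕ

/-- Whether a basis element is odd in the Lie superalgebra (that is, Grassmann even). -/
def Letter.odd (i : Letter) : Bool :=
  match i.1 with
  | .one => true
  | .TX => true
  | .T => false
  | .X => false

/-! ### The structure constants on monomials. -/

section Words

variable {K : Type*} [Field K]

/-- The Koszul sign of two letters. -/
def sg (i j : Letter) : K := if i.odd && j.odd then -1 else 1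

/-- The linear extension of `φ`, evaluated at the bracket of the letters `i` and `j`. -/
def br (i j : Letter) (φ : Letter → K) : K :=
  match i, j with
  | (.one, _), (.one, _) => 0
  | (.one, a), (.T, b) => (2 - a) * φ (.one, a + b)
  -- Wherever `a + b - 1` is truncated, that is for `a = b = 0`, its coefficient is zero, here and
  -- in the cases below.
  | (.one, a), (.X, b) => -a * φ (.one, a + b - 1)
  | (.one, a), (.TX, b) => (2 - a) * φ (.X, a + b) + a * φ (.T, a + b - 1)
  | (.T, a), (.one, b) => -(2 - b) * φ (.one, a + b)
  | (.T, a), (.T, b) => (b - a) * φ (.T, a + b)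
  | (.T, a), (.X, b) => (b - 1) * φ (.X, a + b) - a * φ (.T, a + b - 1)
  | (.T, a), (.TX, b) => (1 + b - a) * φ (.TX, a + b)
  | (.X, a), (.one, b) => b * φ (.one, a + b - 1)
  | (.X, a), (.T, b) => -(a - 1) * φ (.X, a + b) + b * φ (.T, a + b - 1)
  | (.X, a), (.X, b) => (b - a) * φ (.X, a + b - 1)
  | (.X, a), (.TX, b) => (b - a) * φ (.TX, a + b - 1)
  | (.TX, a), (.one, b) => (2 - b) * φ (.X, a + b) + b * φ (.T, a + b - 1)
  | (.TX, a), (.T, b) => -(1 + a - b) * φ (.TX, a + b)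
  | (.TX, a), (.X, b) => -(a - b) * φ (.TX, a + b - 1)
  | (.TX, _), (.TX, _) => 0

theorem sg_comm (i j : Letter) : (sg i j : K) = sg j i := by
  simp only [sg, Bool.and_comm]

theorem sg_mul_self (i j : Letter) : (sg i j : K) * sg i j = 1 := by
  unfold sg; split <;> simp

theorem sg_of_not_odd {i : Letter} (hi : i.odd = false) (j : Letter) : (sg i j : K) = 1 := by
  simp [sg, hi]

theorem sg_of_odd {i j : Letter} (hi : i.odd = true) (hj : j.odd = true) : (sg i j : K) = -1 := by
  simp [sg, hi, hj]

theorem sg_congr_left {i j : Letter} (h : i.odd = j.odd) (l : Letter) :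
    (sg i l : K) = sg j l := by
  simp only [sg, h]

theorem br_add (i j : Letter) (φ ψ : Letter → K) :
    br i j (fun k => φ k + ψ k) = br i j φ + br i j ψ := by
  obtain ⟨m, a⟩ := i; obtain ⟨n, b⟩ := j
  cases m <;> cases n <;> simp only [br] <;> ring

theorem br_mul (i j : Letter) (r : K) (φ : Letter → K) :
    br i j (fun k => r * φ k) = r * br i j φ := by
  obtain ⟨m, a⟩ := i; obtain ⟨n, b⟩ := j
  cases m <;> cases n <;> simp only [br] <;> ring

theorem br_neg (i j : Letter) (φ : Letter → K) :
    br i j (fun k => -φ k) = -br i j φ := by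
  simpa using br_mul i j (-1) φ

theorem br_sub (i j : Letter) (φ ψ : Letter → K) :
    br i j (fun k => φ k - ψ k) = br i j φ - br i j ψ := by
  simp only [sub_eq_add_neg, br_add, br_neg]

theorem br_zero (i j : Letter) : br i j (fun _ => (0 : K)) = 0 := by
  simpa using br_mul i j 0 (fun _ => (0 : K))

theorem br_swap (i j : Letter) (φ : Letter → K) : br j i φ = -sg i j * br i j φ := by
  obtain ⟨m, a⟩ := i; obtain ⟨n, b⟩ := j
  cases m <;> cases n <;> simp [br, sg, Letter.odd, add_comm b a] <;> ring

/-- The bracket of two letters has the sum of their parities. -/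
theorem br_sg (i j l : Letter) (φ : Letter → K) :
    br i j (fun k => sg k l * φ k) = sg i l * sg j l * br i j φ := by
  obtain ⟨m, a⟩ := i; obtain ⟨n, b⟩ := j; obtain ⟨p, c⟩ := l
  cases m <;> cases n <;> cases p <;> simp [br, sg, Letter.odd]

-- The super Jacobi identity, tested against a linear form `φ`. Separating zero from positive
-- exponents removes the truncated subtractions; what remains are polynomial identities in the
-- exponents.
set_option maxHeartbeats 4000000 in
theorem jacobi (i j l : Letter) (φ : Letter → K) :
    br j l (fun k => br i k φ) =
      br i j (fun k => br k l φ) + sg i j * br i l (fun k => br j k φ) := by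
  obtain ⟨m, a⟩ := i; obtain ⟨n, b⟩ := j; obtain ⟨p, c⟩ := l
  cases m <;> cases n <;> cases p <;>
    simp only [br, sg, Letter.odd, Bool.and_true, Bool.and_false, if_true, if_false,
      Bool.false_eq_true] <;>
    rcases a with _ | a <;> rcases b with _ | b <;> rcases c with _ | c <;>
    simp only [Nat.cast_zero, Nat.cast_succ, zero_add, add_zero, zero_mul, neg_zero, mul_zero,
      Nat.zero_sub, Nat.add_sub_cancel, ← add_assoc, Nat.cast_add, add_right_comm _ 1 _,
      sub_zero] <;>
    (try ring_nf)

/-- A bracket of letters is a combination of at most two letters. -/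
theorem exists_br_eq (i j : Letter) :
    ∃ (r s : K) (k l : Letter), ∀ φ : Letter → K, br i j φ = r * φ k + s * φ l := by
  obtain ⟨m, a⟩ := i; obtain ⟨n, b⟩ := j
  cases m <;> cases n <;> simp only [br]
  case T.X => exact ⟨_, _, _, _, fun φ => by rw [sub_eq_add_neg, ← neg_mul]⟩
  case one.one | TX.TX => exact ⟨0, 0, (.one, 0), (.one, 0), fun φ => by simp⟩
  all_goals
    first
      | exact ⟨_, 0, _, (.one, 0), fun φ => (add_eq_left.2 (zero_mul _)).symm⟩
      | exact ⟨_, _, _, _, fun φ => rfl⟩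

theorem br_br_comm (i j l m : Letter) (F : Letter → Letter → K) :
    br i j (fun k => br l m fun k' => F k k') = br l m fun k' => br i j fun k => F k k' := by
  obtain ⟨r, s, k₁, k₂, h⟩ := exists_br_eq (K := K) i j
  simp only [h, br_add, br_mul]

end Words

/-! ### Cartan calculus on functions of words. -/

section WordOperators

variable {K : Type*} [Field K]

/-- Minus the coadjoint action of the letter `i` on functions of words. -/
def lie (i : Letter) : (List Letter → K) → List Letter → K
  | _, [] => 0
  | f, j :: w => -br i j (fun k => f (k :: w)) + sg i j * lie i (fun u => f (j :: u)) w

/-- The differential of functions of words, defined by Cartan's formula. -/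
def diff : (List Letter → K) → List Letter → K
  | _, [] => 0
  | f, i :: w => lie i f w - diff (fun u => f (i :: u)) w

/-- Multiplication by the linear form dual to the letter `a`. -/
def mulGen (a : Letter) : (List Letter → K) → List Letter → K
  | _, [] => 0
  | f, j :: w => (if j = a then f w else 0) - sg a j * mulGen a (fun u => f (j :: u)) w

/-- Super skew-symmetry for functions of words. -/
def IsSkew (f : List Letter → K) : Prop :=
  ∀ (u : List Letter) (i j : Letter) (w : List Letter),
    f (u ++ i :: j :: w) = -sg i j * f (u ++ j :: i :: w)

theorem IsSkew.contract {f : List Letter → K} (hf : IsSkew f) (i : Letter) :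
    IsSkew fun u => f (i :: u) := fun u j k w => hf (i :: u) j k w

theorem IsSkew.head {f : List Letter → K} (hf : IsSkew f) (i j : Letter) (w : List Letter) :
    f (i :: j :: w) = -sg i j * f (j :: i :: w) := hf [] i j w

theorem IsSkew.cons_cons {f : List Letter → K} (hf : IsSkew f) (i j : Letter) :
    (fun w => f (i :: j :: w)) = fun w => -sg i j * f (j :: i :: w) := funext (hf.head i j)

theorem isSkew_zero : IsSkew fun _ => (0 : K) := fun _ _ _ _ => by simp

theorem IsSkew.add {f g : List Letter → K} (hf : IsSkew f) (hg : IsSkew g) :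
    IsSkew fun w => f w + g w := fun u i j w => by simp only [hf u i j w, hg u i j w]; ring

theorem IsSkew.mul {f : List Letter → K} (hf : IsSkew f) (r : K) :
    IsSkew fun w => r * f w := fun u i j w => by simp only [hf u i j w]; ring

theorem IsSkew.sub {f g : List Letter → K} (hf : IsSkew f) (hg : IsSkew g) :
    IsSkew fun w => f w - g w := fun u i j w => by simp only [hf u i j w, hg u i j w]; ring

/-- A skew function of words remains skew when multiplied with a symmetric one. -/
theorem IsSkew.mul_symm {f : List Letter → K} (hf : IsSkew f) {p : List Letter → K}
    (hp : ∀ w w' : List Letter, w.Perm w' → p w = p w') : IsSkew fun w => p w * f w :=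
  fun u i j w => by
    have h : (u ++ i :: j :: w).Perm (u ++ j :: i :: w) := (List.Perm.swap j i w).append_left u
    simp only [hf u i j w, hp _ _ h]
    ring

theorem IsSkew.eq_zero_of_perm {f : List Letter → K} (hf : IsSkew f) {w w' : List Letter}
    (h : w.Perm w') (hw : f w = 0) : f w' = 0 := by
  induction h generalizing f with
  | nil => exact hw
  | cons a _ ih => exact ih (hf.contract a) hw
  | swap a b l =>
    rw [hf.head, hw, mul_zero]
  | trans _ _ ih₁ ih₂ => exact ih₂ hf (ih₁ hf hw)

theorem IsSkew.eq_of_perm {f g : List Letter → K} (hf : IsSkew f) (hg : IsSkew g)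
    {w w' : List Letter} (h : w.Perm w') (hw : f w = g w) : f w' = g w' :=
  sub_eq_zero.1 ((hf.sub hg).eq_zero_of_perm h (sub_eq_zero.2 hw))

theorem lie_add (i : Letter) (f g : List Letter → K) (w : List Letter) :
    lie i (fun u => f u + g u) w = lie i f w + lie i g w := by
  induction w generalizing f g with
  | nil => simp [lie]
  | cons j w ih => simp only [lie, br_add, ih]; ring

theorem lie_mul (i : Letter) (r : K) (f : List Letter → K) (w : List Letter) :
    lie i (fun u => r * f u) w = r * lie i f w := by
  induction w generalizing f with
  | nil => simp [lie]
  | cons j w ih => simp only [lie, br_mul, ih]; ring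

theorem lie_neg (i : Letter) (f : List Letter → K) (w : List Letter) :
    lie i (fun u => -f u) w = -lie i f w := by simpa using lie_mul i (-1) f w

theorem lie_sub (i : Letter) (f g : List Letter → K) (w : List Letter) :
    lie i (fun u => f u - g u) w = lie i f w - lie i g w := by
  simp only [sub_eq_add_neg, lie_add, lie_neg]

theorem lie_zero (i : Letter) (w : List Letter) : lie i (fun _ => (0 : K)) w = 0 := by
  simpa using lie_mul i 0 (fun _ => (0 : K)) w

/-- `lie` commutes with linear extension to brackets. -/
theorem lie_br (i j l : Letter) (F : Letter → List Letter → K) (w : List Letter) :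
    lie i (fun u => br j l (fun k => F k u)) w = br j l (fun k => lie i (F k) w) := by
  induction w generalizing F with
  | nil => simp [lie, br_zero]
  | cons m w ih =>
    simp only [lie, br_add, br_neg, br_mul]
    rw [br_br_comm i m, ih fun k u => F k (m :: u)]

theorem diff_add (f g : List Letter → K) (w : List Letter) :
    diff (fun u => f u + g u) w = diff f w + diff g w := by
  induction w generalizing f g with
  | nil => simp [diff]
  | cons j w ih => simp only [diff, lie_add, ih]; ring

theorem diff_mul (r : K) (f : List Letter → K) (w : List Letter) :
    diff (fun u => r * f u) w = r * diff f w := by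
  induction w generalizing f with
  | nil => simp [diff]
  | cons j w ih => simp only [diff, lie_mul, ih]; ring

theorem diff_neg (f : List Letter → K) (w : List Letter) :
    diff (fun u => -f u) w = -diff f w := by simpa using diff_mul (-1) f w

theorem diff_sub (f g : List Letter → K) (w : List Letter) :
    diff (fun u => f u - g u) w = diff f w - diff g w := by
  simp only [sub_eq_add_neg, diff_add, diff_neg]

theorem diff_zero (w : List Letter) : diff (fun _ => (0 : K)) w = 0 := by
  simpa using diff_mul 0 (fun _ => (0 : K)) w

theorem diff_br (j l : Letter) (F : Letter → List Letter → K) (w : List Letter) :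
    diff (fun u => br j l (fun k => F k u)) w = br j l (fun k => diff (F k) w) := by
  induction w generalizing F with
  | nil => simp [diff, br_zero]
  | cons m w ih =>
    simp only [diff, br_sub, lie_br]
    rw [ih fun k u => F k (m :: u)]

theorem mulGen_mul (a : Letter) (r : K) (f : List Letter → K) (w : List Letter) :
    mulGen a (fun u => r * f u) w = r * mulGen a f w := by
  induction w generalizing f with
  | nil => simp [mulGen]
  | cons j w ih => simp only [mulGen, ih]; split <;> ring

theorem lie_contract_comm {f : List Letter → K} (hf : IsSkew f) (l i j : Letter)
    (w : List Letter) :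
    lie l (fun u => f (i :: j :: u)) w = -sg i j * lie l (fun u => f (j :: i :: u)) w := by
  rw [hf.cons_cons, lie_mul]

theorem diff_contract_comm {f : List Letter → K} (hf : IsSkew f) (i j : Letter)
    (w : List Letter) :
    diff (fun u => f (i :: j :: u)) w = -sg i j * diff (fun u => f (j :: i :: u)) w := by
  rw [hf.cons_cons, diff_mul]

theorem br_cons_comm {f : List Letter → K} (hf : IsSkew f) (i j l : Letter)
    (w : List Letter) :
    br i j (fun k => f (k :: l :: w)) =
      -(sg i l * sg j l) * br i j (fun k => f (l :: k :: w)) := by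
  have h : (fun k => f (k :: l :: w)) = fun k => -(sg k l * f (l :: k :: w)) :=
    funext fun k => by rw [hf.head, neg_mul]
  rw [h, br_neg, br_sg, neg_mul]

theorem IsSkew.lie {f : List Letter → K} (hf : IsSkew f) (l : Letter) : IsSkew (lie l f) := by
  intro u i j w
  induction u generalizing f with
  | nil =>
    simp only [List.nil_append, OddContact.lie]
    rw [br_cons_comm hf l i j, br_cons_comm hf l j i, lie_contract_comm hf l i j w, sg_comm j i]
    linear_combination (br l j (fun k => f (i :: k :: w)) * sg l i) * sg_mul_self (K := K) i j
  | cons m u ih =>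
    have h : (fun k => f (k :: (u ++ i :: j :: w))) =
        fun k => -sg i j * f (k :: (u ++ j :: i :: w)) := funext fun k => hf (k :: u) i j w
    simp only [List.cons_append, OddContact.lie, h, br_mul, ih (hf.contract m)]
    ring

theorem IsSkew.diff {f : List Letter → K} (hf : IsSkew f) : IsSkew (diff f) := by
  intro u i j w
  induction u generalizing f with
  | nil =>
    simp only [List.nil_append, OddContact.diff, OddContact.lie]
    rw [diff_contract_comm hf i j w, br_swap i j, sg_comm j i]
    linear_combination (OddContact.lie j (fun u => f (i :: u)) w
      + br i j (fun k => f (k :: w))) * sg_mul_self (K := K) i j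
  | cons m u ih =>
    simp only [List.cons_append, OddContact.diff, hf.lie m u i j w, ih (hf.contract m)]
    ring

theorem IsSkew.mulGen {f : List Letter → K} (hf : IsSkew f) (a : Letter) :
    IsSkew (mulGen a f) := by
  intro u i j w
  induction u generalizing f with
  | nil =>
    have h : OddContact.mulGen a (fun u => f (i :: j :: u)) w =
        -sg i j * OddContact.mulGen a (fun u => f (j :: i :: u)) w := by
      rw [hf.cons_cons, mulGen_mul]
    simp only [List.nil_append, OddContact.mulGen, h]
    have e := sg_mul_self (K := K) i j
    by_cases hi : i = a <;> by_cases hj : j = a <;>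
      simp only [hi, hj, if_true, if_false, sg_comm (K := K) a]
    · subst hi; subst hj
      linear_combination -f (j :: w) * e
    · subst hi
      linear_combination -f (j :: w) * sg_mul_self (K := K) j i
    · subst hj
      ring
    · ring
  | cons m u ih =>
    simp only [List.cons_append, OddContact.mulGen, ih (hf.contract m)]
    split
    · rw [hf u i j w]; ring
    · ring

/-- Compatibility of the operators `lie` with the bracket. The Jacobi identity accounts for the
terms in which both operators hit the first letter; the mixed terms cancel. -/
theorem lie_lie {f : List Letter → K} (hf : IsSkew f) (i j : Letter) (w : List Letter) :
    br i j (fun k => lie k f w) =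
      sg i j * lie i (lie j f) w - lie j (lie i f) w := by
  induction w generalizing f with
  | nil => simp [lie, br_zero]
  | cons l w ih =>
    have h₁ : ∀ i j : Letter, lie i (fun u => lie j f (l :: u)) w =
        -br j l (fun k => lie i (fun u => f (k :: u)) w)
          + sg j l * lie i (lie j (fun u => f (l :: u))) w := fun i j => by
      simp only [lie, lie_add, lie_neg, lie_mul, lie_br]
    have h₂ : ∀ i j : Letter, br i l (fun k => lie j f (k :: w)) =
        -br i l (fun k => br j k fun m => f (m :: w))
          + sg i j * sg l j * br i l (fun k => lie j (fun u => f (k :: u)) w) := fun i j => by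
      simp only [lie, br_add, br_neg]
      simp only [sg_comm (K := K) j, br_sg]
    have h₃ : br i j (fun k => lie k f (l :: w)) =
        -br i j (fun k => br k l fun m => f (m :: w))
          + sg i l * sg j l * br i j (fun k => lie k (fun u => f (l :: u)) w) := by
      simp only [lie, br_add, br_neg, br_sg]
    rw [lie, lie, h₁, h₁, h₂, h₂, h₃, ih (hf.contract l), sg_comm j i, sg_comm l i, sg_comm l j]
    linear_combination jacobi i j l (fun m => f (m :: w))
      + sg j l * br i l (fun k => lie j (fun u => f (k :: u)) w) * sg_mul_self (K := K) i j

theorem lie_diff {f : List Letter → K} (hf : IsSkew f) (i : Letter) (w : List Letter) :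
    lie i (diff f) w = diff (lie i f) w := by
  induction w generalizing f with
  | nil => simp [lie, diff]
  | cons j w ih =>
    have h₁ : lie i (fun u => diff f (j :: u)) w =
        lie i (lie j f) w - lie i (diff fun u => f (j :: u)) w := by
      simp only [diff, lie_sub]
    have h₂ : diff (fun u => lie i f (j :: u)) w =
        -br i j (fun k => diff (fun u => f (k :: u)) w)
          + sg i j * diff (lie i fun u => f (j :: u)) w := by
      simp only [lie, diff_add, diff_neg, diff_mul, diff_br]
    rw [lie, diff, h₁, h₂, ih (hf.contract j)]
    simp only [diff, br_sub]
    rw [lie_lie hf]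
    ring

/-- Contracting with the first letter `i` gives `L_i d f - d(L_i f) + d d (ι_i f)`: the first two
terms cancel by `lie_diff`, the last one vanishes by induction on the length. -/
theorem diff_diff {f : List Letter → K} (hf : IsSkew f) (w : List Letter) :
    diff (diff f) w = 0 := by
  induction w generalizing f with
  | nil => simp [diff]
  | cons i w ih =>
    have h : diff (fun u => diff f (i :: u)) w =
        diff (lie i f) w - diff (diff fun u => f (i :: u)) w := by
      simp only [diff, diff_sub]
    rw [diff, h, ih (hf.contract i), lie_diff hf]
    ring

end WordOperators

/-! ### Continuity, supports, and cochains dual to a word. -/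

section Support

variable {K : Type*} [Field K]

/-- `f` vanishes on the words that contain a letter `x^n m` with large `n`. -/
def IsContinuousOnWords (f : List Letter → K) : Prop :=
  ∃ N : ℕ, ∀ w : List Letter, (∃ l ∈ w, N ≤ l.2) → f w = 0

/-- A bracket lowers the total exponent of `x` by at most one. This is why the bound `N` for a
cochain becomes `N + 1` for its differential. -/
theorem br_eq_zero {i j : Letter} {φ : Letter → K}
    (h : ∀ k : Letter, i.2 + j.2 ≤ k.2 + 1 → φ k = 0) : br i j φ = 0 := by
  obtain ⟨m, a⟩ := i; obtain ⟨n, b⟩ := j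
  have h₀ : ∀ m, φ (m, a + b) = 0 := fun m => h (m, a + b) (by simp)
  have h₁ : ∀ m, φ (m, a + b - 1) = 0 := fun m => h (m, a + b - 1) (by simp; omega)
  cases m <;> cases n <;> simp [br, h₀, h₁]

theorem lie_eq_zero_of_large {N : ℕ} {f : List Letter → K}
    (hf : ∀ w : List Letter, (∃ l ∈ w, N ≤ l.2) → f w = 0) {i : Letter} {w : List Letter}
    (h : N + 1 ≤ i.2 ∨ ∃ l ∈ w, N + 1 ≤ l.2) : lie i f w = 0 := by
  induction w generalizing f with
  | nil => rfl
  | cons j w ih =>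
    have hj : ∀ u : List Letter, (∃ l ∈ u, N ≤ l.2) → f (j :: u) = 0 := fun u ⟨l, hl, hN⟩ =>
      hf _ ⟨l, List.mem_cons_of_mem j hl, hN⟩
    rw [lie]
    by_cases hw : ∃ l ∈ w, N + 1 ≤ l.2
    · obtain ⟨l, hl, hN⟩ := hw
      rw [ih hj (Or.inr ⟨l, hl, hN⟩), br_eq_zero fun k _ =>
        hf _ ⟨l, List.mem_cons_of_mem k hl, by omega⟩]
      simp
    · have h' : N + 1 ≤ i.2 ∨ N + 1 ≤ j.2 := by
        rcases h with h | ⟨l, hl, hN⟩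
        · exact Or.inl h
        · rcases List.mem_cons.1 hl with rfl | hl
          · exact Or.inr hN
          · exact absurd ⟨l, hl, hN⟩ hw
      rw [br_eq_zero fun k hk => hf _ ⟨k, List.mem_cons_self, by omega⟩]
      rcases h' with h' | h'
      · rw [ih hj (Or.inl h')]; simp
      · have e : (fun u => f (j :: u)) = fun _ => 0 := funext fun u =>
          hf _ ⟨j, List.mem_cons_self, by omega⟩
        rw [e, lie_zero]; simp

theorem diff_eq_zero_of_large {N : ℕ} {f : List Letter → K}
    (hf : ∀ w : List Letter, (∃ l ∈ w, N ≤ l.2) → f w = 0) {w : List Letter}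
    (h : ∃ l ∈ w, N + 1 ≤ l.2) : diff f w = 0 := by
  induction w generalizing f with
  | nil => rfl
  | cons j w ih =>
    have hj : ∀ u : List Letter, (∃ l ∈ u, N ≤ l.2) → f (j :: u) = 0 := fun u ⟨l, hl, hN⟩ =>
      hf _ ⟨l, List.mem_cons_of_mem j hl, hN⟩
    rw [diff]
    obtain ⟨l, hl, hN⟩ := h
    rcases List.mem_cons.1 hl with rfl | hl
    · have e : (fun u => f (l :: u)) = fun _ => 0 := funext fun u =>
        hf _ ⟨l, List.mem_cons_self, by omega⟩
      rw [e, diff_zero, lie_eq_zero_of_large hf (Or.inl hN), sub_zero]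
    · rw [ih hj ⟨l, hl, hN⟩, lie_eq_zero_of_large hf (Or.inr ⟨l, hl, hN⟩), sub_zero]

namespace IsContinuousOnWords

variable {f g : List Letter → K}

theorem zero : IsContinuousOnWords fun _ => (0 : K) := ⟨0, fun _ _ => rfl⟩

theorem diff (hf : IsContinuousOnWords f) : IsContinuousOnWords (diff f) :=
  let ⟨N, hN⟩ := hf
  ⟨N + 1, fun _ hw => diff_eq_zero_of_large hN hw⟩

theorem add (hf : IsContinuousOnWords f) (hg : IsContinuousOnWords g) :
    IsContinuousOnWords fun w => f w + g w := by
  obtain ⟨N, hN⟩ := hf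
  obtain ⟨M, hM⟩ := hg
  refine ⟨max N M, fun w ⟨l, hl, h⟩ => ?_⟩
  simp only [hN w ⟨l, hl, (le_max_left _ _).trans h⟩, hM w ⟨l, hl, (le_max_right _ _).trans h⟩,
    add_zero]

theorem mul (hf : IsContinuousOnWords f) (p : List Letter → K) :
    IsContinuousOnWords fun w => p w * f w := by
  obtain ⟨N, hN⟩ := hf
  exact ⟨N, fun w hw => by simp only [hN w hw, mul_zero]⟩

theorem sub (hf : IsContinuousOnWords f) (hg : IsContinuousOnWords g) :
    IsContinuousOnWords fun w => f w - g w := by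
  simpa [sub_eq_add_neg] using hf.add (hg.mul fun _ => -1)

theorem contract (hf : IsContinuousOnWords f) (i : Letter) :
    IsContinuousOnWords fun w => f (i :: w) := by
  obtain ⟨N, hN⟩ := hf
  exact ⟨N, fun w ⟨l, hl, h⟩ => hN _ ⟨l, List.mem_cons_of_mem i hl, h⟩⟩

theorem mulGen (hf : IsContinuousOnWords f) (a : Letter) :
    IsContinuousOnWords (mulGen a f) := by
  obtain ⟨N, hN⟩ := hf
  have key : ∀ (w : List Letter) (f : List Letter → K),
      (∀ w : List Letter, (∃ l ∈ w, max N (a.2 + 1) ≤ l.2) → f w = 0) →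
      (∃ l ∈ w, max N (a.2 + 1) ≤ l.2) → OddContact.mulGen a f w = 0 := by
    intro w
    induction w with
    | nil => exact fun _ _ _ => rfl
    | cons j w ih =>
      rintro f hf ⟨l, hl, h⟩
      rw [OddContact.mulGen]
      rcases List.mem_cons.1 hl with rfl | hl
      · have e : (fun u => f (l :: u)) = fun u => 0 * f u := funext fun u => by
          rw [hf _ ⟨l, List.mem_cons_self, h⟩, zero_mul]
        have ha : l ≠ a := by
          rintro rfl
          have := (le_max_right _ _).trans h
          omega
        rw [e, mulGen_mul, if_neg ha]; simp
      · rw [ih _ (fun u ⟨l, hl, h⟩ => hf _ ⟨l, List.mem_cons_of_mem j hl, h⟩) ⟨l, hl, h⟩,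
          hf _ ⟨l, hl, h⟩]
        simp
  exact ⟨_, fun w hw => key w f (fun w ⟨l, hl, h⟩ => hN w ⟨l, hl, (le_max_left _ _).trans h⟩) hw⟩

end IsContinuousOnWords

theorem lie_congr_length {f : List Letter → K} {i : Letter} {w : List Letter}
    (h : ∀ u : List Letter, u.length = w.length → f u = 0) : lie i f w = 0 := by
  induction w generalizing f with
  | nil => rfl
  | cons j w ih =>
    have e : (fun k => f (k :: w)) = fun _ => 0 := funext fun k => h _ (by simp)
    rw [lie, e, br_zero, ih fun u hu => h _ (by simp [hu])]
    simp

theorem diff_eq_zero_of_length {f : List Letter → K} {w : List Letter}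
    (h : ∀ u : List Letter, u.length + 1 = w.length → f u = 0) : diff f w = 0 := by
  induction w generalizing f with
  | nil => rfl
  | cons j w ih =>
    rw [diff, lie_congr_length fun u hu => h _ (by simp [hu]), ih fun u hu => h _ (by simp [hu]),
      sub_zero]

theorem mulGen_eq_zero {a : Letter} {f : List Letter → K} {w : List Letter}
    (h : ∀ u : List Letter, (a :: u).Perm w → f u = 0) : mulGen a f w = 0 := by
  induction w generalizing f with
  | nil => rfl
  | cons j w ih =>
    rw [mulGen, ih fun u hu => h _ ((List.Perm.swap j a u).trans (hu.cons j))]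
    split
    case isTrue hj => rw [h w (hj ▸ List.Perm.refl _)]; simp
    case isFalse => simp

/-- Euler's identity. -/
theorem mulGen_contract {f : List Letter → K} (hf : IsSkew f) (a : Letter) (w : List Letter) :
    mulGen a (fun u => f (a :: u)) w = w.count a * f w := by
  induction w generalizing f with
  | nil => simp [mulGen]
  | cons j w ih =>
    rw [mulGen, hf.cons_cons a j, mulGen_mul, ih (hf.contract j)]
    by_cases hj : j = a
    · subst hj
      rw [if_pos rfl, List.count_cons_self]
      push_cast
      linear_combination w.count j * f (j :: w) * sg_mul_self (K := K) j j
    · rw [if_neg hj, List.count_cons_of_ne hj]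
      linear_combination w.count a * f (j :: w) * sg_mul_self (K := K) a j

theorem mulGen_cons_self {f : List Letter → K} (hf : IsSkew f) (a : Letter) (w : List Letter) :
    mulGen a f (a :: w) = (1 - sg a a * w.count a) * f w := by
  rw [mulGen, if_pos rfl, mulGen_contract hf]; ring

/-- A cochain that is dual to the monomial given by a word. -/
theorem exists_dual [CharZero K] {u : List Letter}
    (hu : ∀ a ∈ u, a.odd = false → u.count a ≤ 1) :
    ∃ f : List Letter → K, IsSkew f ∧ IsContinuousOnWords f ∧ f u = 1 ∧
      ∀ w : List Letter, ¬ w.Perm u → f w = 0 := by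
  induction u with
  | nil =>
    refine ⟨fun w => if w = [] then 1 else 0, fun u i j w => by simp, ⟨0, ?_⟩, by simp, ?_⟩
    · rintro w ⟨l, hl, -⟩
      exact if_neg (List.ne_nil_of_mem hl)
    · intro w hw
      exact if_neg fun h : w = [] => hw (h ▸ List.Perm.refl _)
  | cons a u ih =>
    obtain ⟨f, hf, hc, h₁, h₀⟩ := ih fun b hb ho =>
      (List.count_le_count_cons).trans (hu b (List.mem_cons_of_mem a hb) ho)
    -- The normalising factor from `mulGen_cons_self` is `1 + count` for an odd letter, invertible
    -- in characteristic zero; an even letter does not recur, and the factor is `1`.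
    have hr : (1 - sg a a * u.count a : K) ≠ 0 := by
      cases ho : a.odd with
      | true =>
        rw [sg_of_odd ho ho]
        have : ((u.count a + 1 : ℕ) : K) ≠ 0 := Nat.cast_ne_zero.2 (Nat.succ_ne_zero _)
        push_cast at this
        intro h
        apply this
        linear_combination h
      | false =>
        have := hu a List.mem_cons_self ho
        rw [List.count_cons_self] at this
        have : u.count a = 0 := by omega
        simp [this]
    refine ⟨fun w => (1 - sg a a * u.count a : K)⁻¹ * mulGen a f w, (hf.mulGen a).mul _,
      (hc.mulGen a).mul _, ?_, fun w hw => ?_⟩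
    · simp only [mulGen_cons_self hf, h₁, mul_one, inv_mul_cancel₀ hr]
    · simp only
      rw [mulGen_eq_zero fun v hv => h₀ v fun h => hw (hv.symm.trans (h.cons a)), mul_zero]

end Support

/-! ### The torus spanned by `xX` and `T`, and reduction to degree zero. -/

section Grading

variable {K : Type*} [Field K]

/-- A `ℤ`-grading of the letters that is respected by the bracket. -/
def IsGrading (K : Type*) [Field K] (ν : Letter → ℤ) : Prop :=
  ∀ (i j : Letter) (g : ℤ → K) (φ : Letter → K),
    br i j (fun k => g (ν k) * φ k) = g (ν i + ν j) * br i j φ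

/-- The total degree of a word. -/
def wordDegree (ν : Letter → ℤ) (w : List Letter) : ℤ := (w.map ν).sum

theorem wordDegree_cons (ν : Letter → ℤ) (i : Letter) (w : List Letter) :
    wordDegree ν (i :: w) = ν i + wordDegree ν w := by simp [wordDegree]

theorem wordDegree_perm (ν : Letter → ℤ) {w w' : List Letter} (h : w.Perm w') :
    wordDegree ν w = wordDegree ν w' := (h.map ν).sum_eq

theorem lie_grading {ν : Letter → ℤ} (hν : IsGrading K ν) (i : Letter) (g : ℤ → K)
    (f : List Letter → K) (w : List Letter) :
    lie i (fun u => g (wordDegree ν u) * f u) w = g (ν i + wordDegree ν w) * lie i f w := by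
  induction w generalizing f g with
  | nil => simp [lie]
  | cons j w ih =>
    simp only [lie, wordDegree_cons]
    rw [hν i j (fun z => g (z + wordDegree ν w)), ih fun z => g (ν j + z)]
    simp only [add_left_comm (ν j), add_assoc]
    ring

theorem diff_grading {ν : Letter → ℤ} (hν : IsGrading K ν) (g : ℤ → K)
    (f : List Letter → K) (w : List Letter) :
    diff (fun u => g (wordDegree ν u) * f u) w = g (wordDegree ν w) * diff f w := by
  induction w generalizing f g with
  | nil => simp [diff]
  | cons j w ih =>
    simp only [diff, lie_grading hν, wordDegree_cons]
    rw [ih fun z => g (ν j + z)]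
    ring

/-- `f` is supported on the words of degree zero. -/
def IsInvariant (ν : Letter → ℤ) (f : List Letter → K) : Prop :=
  ∀ w : List Letter, wordDegree ν w ≠ 0 → f w = 0

theorem IsInvariant.diff {ν : Letter → ℤ} (hν : IsGrading K ν) {f : List Letter → K}
    (hf : IsInvariant ν f) : IsInvariant ν (diff f) := by
  intro w hw
  -- Multiplication by the indicator of degree zero fixes `f` and commutes with the differential.
  have e : f = fun u => (if wordDegree ν u = 0 then 1 else 0) * f u := funext fun u => by
    by_cases hu : wordDegree ν u = 0
    · simp [hu]
    · simp [hf u hu]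
  rw [e, diff_grading hν (fun z => if z = 0 then 1 else 0), if_neg hw, zero_mul]

theorem IsInvariant.add {ν : Letter → ℤ} {f g : List Letter → K} (hf : IsInvariant ν f)
    (hg : IsInvariant ν g) : IsInvariant ν fun w => f w + g w := fun w hw => by
  simp only [hf w hw, hg w hw, add_zero]

theorem IsInvariant.mul {ν : Letter → ℤ} {f : List Letter → K} (hf : IsInvariant ν f) (r : K) :
    IsInvariant ν fun w => r * f w := fun w hw => by
  simp only [hf w hw, mul_zero]

/-- `t` is an even letter that acts diagonally, with the eigenvalues `ν`. -/
def IsTorusLetter (K : Type*) [Field K] (t : Letter) (ν : Letter → ℤ) : Prop :=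
  t.odd = false ∧ ∀ (j : Letter) (φ : Letter → K), br t j φ = ν j * φ j

theorem lie_torus {t : Letter} {ν : Letter → ℤ} (ht : IsTorusLetter K t ν)
    (f : List Letter → K) (w : List Letter) : lie t f w = -wordDegree ν w * f w := by
  induction w generalizing f with
  | nil => simp [lie, wordDegree]
  | cons j w ih =>
    rw [lie, ht.2, ih, sg_of_not_odd ht.1, wordDegree_cons]
    push_cast
    ring

theorem diff_torus_cons {t : Letter} {ν : Letter → ℤ} (ht : IsTorusLetter K t ν)
    (f : List Letter → K) {w : List Letter} (hw : wordDegree ν w = 0) :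
    diff f (t :: w) = -diff (fun u => f (t :: u)) w := by
  rw [diff, lie_torus ht, hw]; simp

/-- A cocycle is cohomologous to its part of degree zero. -/
theorem exists_invariant [CharZero K] {t : Letter} {ν : Letter → ℤ} (ht : IsTorusLetter K t ν)
    (hν : IsGrading K ν) {f : List Letter → K} (hf : IsSkew f) (hc : IsContinuousOnWords f)
    (hd : ∀ w, diff f w = 0) :
    ∃ b : List Letter → K, IsSkew b ∧ IsContinuousOnWords b ∧
      ∀ w, f w - diff b w = if wordDegree ν w = 0 then f w else 0 := by
  -- By the homotopy formula, `d ι_t + ι_t d` multiplies by minus the degree, so `ι_t f` divided by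
  -- this scalar is a primitive of the part of nonzero degree. The convention `0⁻¹ = 0` leaves the
  -- part of degree zero untouched.
  refine ⟨fun w => (-wordDegree ν w : K)⁻¹ * f (t :: w),
    (hf.contract t).mul_symm fun w w' h => by rw [wordDegree_perm ν h],
    (hc.contract t).mul _, fun w => ?_⟩
  rw [diff_grading hν (fun z => (-z : K)⁻¹)]
  have h := hd (t :: w)
  rw [diff, lie_torus ht] at h
  split
  case isTrue h0 => simp [h0]
  case isFalse h0 =>
    have h0' : (wordDegree ν w : K) ≠ 0 := Int.cast_ne_zero.2 h0
    rw [← sub_eq_zero.1 h]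
    field_simp
    ring

/-- The eigenvalues of `xX`. -/
def degE : Letter → ℤ
  | (.one, n) => n
  | (.T, n) => n
  | (.X, n) => n - 1
  | (.TX, n) => n - 1

/-- The eigenvalues of `T`. -/
def degH : Letter → ℤ
  | (.one, n) => n - 2
  | (.T, n) => n
  | (.X, n) => n - 1
  | (.TX, n) => n + 1

theorem isTorusLetter_E : IsTorusLetter K (.X, 1) degE := by
  refine ⟨rfl, ?_⟩
  rintro ⟨m, n⟩ φ
  cases m <;> simp [br, degE]

theorem isTorusLetter_H : IsTorusLetter K (.T, 0) degH := by
  refine ⟨rfl, ?_⟩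
  rintro ⟨m, n⟩ φ
  cases m <;> simp [br, degH, add_comm]

theorem isGrading_degE : IsGrading K degE := by
  rintro ⟨m, a⟩ ⟨n, b⟩ g φ
  cases m <;> cases n <;> rcases a with _ | a <;> rcases b with _ | b <;>
    simp [br, degE] <;> ring_nf

theorem isGrading_degH : IsGrading K degH := by
  rintro ⟨m, a⟩ ⟨n, b⟩ g φ
  cases m <;> cases n <;> rcases a with _ | a <;> rcases b with _ | b <;>
    simp [br, degH] <;> ring_nf

end Grading

/-! ### The acyclic ideal generated by the form dual to `X`. -/

section Pairs

variable {K : Type*} [Field K]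

/-- Among the brackets of two letters in `P`, only those of `a` and `b` contribute to the values
of `f`. -/
def OnlyPair (P : Letter → Prop) (a b : Letter) (f : List Letter → K) : Prop :=
  ∀ i j : Letter, P i → P j → ¬ (i = a ∧ j = b) → ¬ (i = b ∧ j = a) →
    ∀ u v : List Letter, (∀ l ∈ u, P l) → (∀ l ∈ v, P l) → br i j (fun k => f (u ++ k :: v)) = 0

namespace OnlyPair

variable {P : Letter → Prop} {a b : Letter} {f : List Letter → K}

theorem contract (hf : OnlyPair P a b f) {l : Letter} (hl : P l) :
    OnlyPair P a b fun w => f (l :: w) := fun i j hi hj h h' u v hu hv =>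
  hf i j hi hj h h' (l :: u) v (List.forall_mem_cons.2 ⟨hl, hu⟩) hv

theorem symm (hf : OnlyPair P a b f) : OnlyPair P b a f :=
  fun i j hi hj h h' => hf i j hi hj h' h

theorem lie_eq_zero (hf : OnlyPair P a b f) {i : Letter} (hi : P i) {w : List Letter}
    (hw : ∀ l ∈ w, P l) (h : ∀ l ∈ w, ¬ (i = a ∧ l = b) ∧ ¬ (i = b ∧ l = a)) :
    lie i f w = 0 := by
  induction w generalizing f with
  | nil => rfl
  | cons j w ih =>
    obtain ⟨hj, hw⟩ := List.forall_mem_cons.1 hw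
    obtain ⟨h₁, h⟩ := List.forall_mem_cons.1 h
    have e := hf i j hi hj h₁.1 h₁.2 [] w (by simp) hw
    simp only [List.nil_append] at e
    rw [lie, e, ih (hf.contract hj) hw h]
    simp

theorem diff_eq_zero (hf : OnlyPair P a b f) {w : List Letter}
    (hw : ∀ l ∈ w, P l) (h : ¬ (a ∈ w ∧ b ∈ w)) : diff f w = 0 := by
  induction w generalizing f with
  | nil => rfl
  | cons j w ih =>
    obtain ⟨hj, hw⟩ := List.forall_mem_cons.1 hw
    rw [diff, ih (hf.contract hj) hw fun h' =>
      h ⟨List.mem_cons_of_mem j h'.1, List.mem_cons_of_mem j h'.2⟩,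
      hf.lie_eq_zero hj hw, sub_zero]
    refine fun l hl => ⟨?_, ?_⟩
    · rintro ⟨rfl, rfl⟩
      exact h ⟨List.mem_cons_self, List.mem_cons_of_mem _ hl⟩
    · rintro ⟨rfl, rfl⟩
      exact h ⟨List.mem_cons_of_mem _ hl, List.mem_cons_self⟩

/-- Each occurrence of `b` in `w` may be replaced by the bracket; the extra `b` in front, moved to
the vacated place, restores `w`. As `a` and `b` have the same parity, all these terms have the same
sign. -/
theorem lie_contract (hf : OnlyPair P a b f) (hs : IsSkew f) (ha : a.odd = true)
    (hb : b.odd = true) (hab : a ≠ b) (hPa : P a) (hPb : P b) {w : List Letter}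
    (hw : ∀ l ∈ w, P l) :
    lie a (fun u => f (b :: u)) w = w.count b * br a b (fun k => f (k :: w)) := by
  induction w generalizing f with
  | nil => simp [lie]
  | cons j w ih =>
    obtain ⟨hj, hw⟩ := List.forall_mem_cons.1 hw
    have e : (sg a j : K) = sg b j := sg_congr_left (ha.trans hb.symm) j
    rw [lie, hs.cons_cons b j, lie_mul, ih (hf.contract hj) (hs.contract j) hw,
      br_cons_comm hs a b j]
    by_cases hjb : j = b
    · subst hjb
      rw [List.count_cons_self, sg_of_odd ha hb, sg_of_odd hb hb]
      push_cast
      ring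
    · have e' := hf a j hPa hj (fun h => hjb h.2) (fun h => hab h.1) [b] w (by simpa using hPb) hw
      simp only [List.singleton_append] at e'
      rw [List.count_cons_of_ne hjb, e', e]
      ring

theorem diff_contract (hf : OnlyPair P a b f) (hs : IsSkew f) (ha : a.odd = true)
    (hb : b.odd = true) (hab : a ≠ b) (hPa : P a) (hPb : P b) {w : List Letter}
    (hw : ∀ l ∈ w, P l) :
    diff (fun u => f (a :: b :: u)) w =
      -(w.count a * w.count b * br a b (fun k => f (k :: w))) := by
  induction w generalizing f with
  | nil => simp [diff]
  | cons j w ih =>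
    obtain ⟨hj, hw⟩ := List.forall_mem_cons.1 hw
    have e : (sg a j : K) = sg b j := sg_congr_left (ha.trans hb.symm) j
    have e₁ : (fun u => f (a :: b :: j :: u)) = fun u => f (j :: a :: b :: u) := funext fun u => by
      rw [(hs.contract a).head b j, hs.head a j, e]
      linear_combination f (j :: a :: b :: u) * sg_mul_self (K := K) b j
    have e₂ : (fun u => f (a :: b :: u)) = fun u => f (b :: a :: u) := funext fun u => by
      rw [hs.head, sg_of_odd ha hb]; ring
    have e₃ : br a b (fun k => f (k :: j :: w)) = -br a b (fun k => f (j :: k :: w)) := by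
      rw [br_cons_comm hs, e, sg_mul_self]; ring
    rw [diff, e₁, ih (hf.contract hj) (hs.contract j) hw, e₃]
    by_cases hja : j = a
    · subst hja
      rw [(hf.contract hPa).lie_contract (hs.contract j) ha hb hab hPa hPb hw,
        List.count_cons_self, List.count_cons_of_ne hab]
      push_cast
      ring
    · by_cases hjb : j = b
      · subst hjb
        rw [e₂, (hf.contract hPb).symm.lie_contract (hs.contract j) hb ha hab.symm hPb hPa hw,
          List.count_cons_self, List.count_cons_of_ne hja, br_swap, sg_of_odd ha hb]
        push_cast
        ring
      · rw [((hf.contract hPa).contract hPb).lie_eq_zero hj hw fun l _ =>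
          ⟨fun h => hja h.1, fun h => hjb h.1⟩, List.count_cons_of_ne hja,
          List.count_cons_of_ne hjb]
        ring

/-- The factor counts the ways to choose one `a` and one `b` from `a :: b :: w`; all choices
contribute equally because both letters are odd. -/
theorem diff_cons_cons (hf : OnlyPair P a b f) (hs : IsSkew f) (ha : a.odd = true)
    (hb : b.odd = true) (hab : a ≠ b) (hPa : P a) (hPb : P b) {w : List Letter}
    (hw : ∀ l ∈ w, P l) :
    diff f (a :: b :: w) =
      -((w.count a + 1) * (w.count b + 1) * br a b (fun k => f (k :: w))) := by
  rw [diff, diff, lie, hf.lie_contract hs ha hb hab hPa hPb hw,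
    hf.symm.lie_contract hs hb ha hab.symm hPb hPa hw,
    hf.diff_contract hs ha hb hab hPa hPb hw, br_swap a b, sg_of_odd ha hb]
  ring

end OnlyPair

/-- For a form `φ` supported at `X`: apart from brackets with `X` itself, only that of `TX` and `1`
has a component along `X`, because all others land on `x^n X` with `n > 0`, on other monomials, or
vanish. -/
theorem br_eq_zero_of_ne {i j : Letter} (hi : i ≠ (.X, 0)) (hj : j ≠ (.X, 0))
    (h : ¬ (i = (.TX, 0) ∧ j = (.one, 0))) (h' : ¬ (i = (.one, 0) ∧ j = (.TX, 0)))
    {φ : Letter → K} (hφ : ∀ k, k ≠ (.X, 0) → φ k = 0) : br i j φ = 0 := by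
  have hX : ∀ n : ℕ, n ≠ 0 → φ (.X, n) = 0 := fun n hn => hφ _ (by simpa using hn)
  have h₁ : ∀ n, φ (.one, n) = 0 := fun n => hφ _ (by simp)
  have h₂ : ∀ n, φ (.T, n) = 0 := fun n => hφ _ (by simp)
  have h₃ : ∀ n, φ (.TX, n) = 0 := fun n => hφ _ (by simp)
  obtain ⟨m, a⟩ := i; obtain ⟨n, b⟩ := j
  cases m <;> cases n <;> simp only [br, h₁, h₂, h₃, mul_zero, add_zero, sub_zero] <;>
    simp only [ne_eq, Prod.mk.injEq, true_and, reduceCtorEq, false_and,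
      not_false_eq_true] at hi hj h h'
  case one.TX => rw [hX _ (by omega), mul_zero]
  case TX.one => rw [hX _ (by omega), mul_zero]
  case T.X => rw [hX _ (by omega), mul_zero]
  case X.T => rw [hX _ (by omega), mul_zero]
  case X.X =>
    by_cases hab : a = b
    · simp [hab]
    · rw [hX _ (by omega), mul_zero]

theorem onlyPair_of_vanish {f : List Letter → K} (hf : ∀ w, (.X, 0) ∉ w → f w = 0) :
    OnlyPair (· ≠ (.X, 0)) (.TX, 0) (.one, 0) f := by
  intro i j hi hj h h' u v hu hv
  refine br_eq_zero_of_ne hi hj h h' fun k hk => hf _ fun hmem => ?_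
  rcases List.mem_append.1 hmem with hm | hm
  · exact hu _ hm rfl
  · rcases List.mem_cons.1 hm with rfl | hm
    · exact hk rfl
    · exact hv _ hm rfl

/-- This is `dξ` modulo `ξ`: the values on words with one `X` can be recovered from the differential
on words without `X`. The factor `2` comes from `[TX, 1] = 2X`. -/
theorem diff_of_vanish {f : List Letter → K} (hs : IsSkew f)
    (hf : ∀ w, (.X, 0) ∉ w → f w = 0) {w : List Letter} (hw : (.X, 0) ∉ w) :
    diff f ((.TX, 0) :: (.one, 0) :: w) =
      -(2 * (w.count (.TX, 0) + 1) * (w.count (.one, 0) + 1) * f ((.X, 0) :: w)) := by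
  rw [(onlyPair_of_vanish hf).diff_cons_cons hs rfl rfl (by simp) (by simp) (by simp)
    fun l hl h => hw (h ▸ hl)]
  simp [br]
  ring

theorem IsSkew.eq_zero_of_count [CharZero K] {f : List Letter → K} (hf : IsSkew f) {a : Letter}
    (ha : a.odd = false) {w : List Letter} (hw : 2 ≤ w.count a) : f w = 0 := by
  obtain ⟨u, hu⟩ : ∃ u, w.Perm (a :: a :: u) := by
    have h₁ := List.perm_cons_erase (List.count_pos_iff.1 (by omega : 0 < w.count a))
    have h₂ : 0 < (w.erase a).count a := by rw [List.count_erase_self]; omega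
    exact ⟨_, h₁.trans ((List.perm_cons_erase (List.count_pos_iff.1 h₂)).cons a)⟩
  refine hf.eq_zero_of_perm hu.symm ?_
  have h := hf.head a a u
  rw [sg_of_not_odd ha] at h
  have : (2 : K) * f (a :: a :: u) = 0 := by linear_combination h
  simpa using this

theorem perm_cons_cons {a b : Letter} (hab : a ≠ b) {w : List Letter} (ha : a ∈ w) (hb : b ∈ w) :
    ∃ u, w.Perm (a :: b :: u) :=
  ⟨_, (List.perm_cons_erase ha).trans
    ((List.perm_cons_erase ((List.mem_erase_of_ne hab.symm).2 hb)).cons a)⟩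

/-- The differential graded ideal generated by the linear form dual to `X` is acyclic: it
consists of the cochains that vanish unless `X` or both `TX` and `1` are among the arguments. -/
theorem exists_primitive [CharZero K] {f : List Letter → K} (hf : IsSkew f)
    (hc : IsContinuousOnWords f) (hd : ∀ w, diff f w = 0)
    (h : ∀ w : List Letter, (.X, 0) ∉ w → ¬ ((.TX, 0) ∈ w ∧ (.one, 0) ∈ w) → f w = 0) :
    ∃ b : List Letter → K, IsSkew b ∧ IsContinuousOnWords b ∧
      (∀ w, (.X, 0) ∉ w → b w = 0) ∧ ∀ w, diff b w = f w := by
  -- The primitive is `ξ R`. By `diff_of_vanish`, `p` is the scalar that makes its differential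
  -- agree with `f` on words without `X`.
  let p : List Letter → K := fun w => if (.X, 0) ∈ w then 0 else
    (-(2 * (w.count (.TX, 0) + 1) * (w.count (.one, 0) + 1)))⁻¹
  let R : List Letter → K := fun w => p w * f ((.TX, 0) :: (.one, 0) :: w)
  have hR : IsSkew R := ((hf.contract _).contract _).mul_symm fun w w' hw => by
    simp only [p, hw.mem_iff, hw.count_eq]
  have hb₀ : ∀ w : List Letter, (.X, 0) ∉ w → mulGen (.X, 0) R w = 0 := fun w hw =>
    mulGen_eq_zero fun u hu => absurd (hu.mem_iff.1 List.mem_cons_self) hw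
  have hb := hR.mulGen (.X, 0)
  refine ⟨mulGen (.X, 0) R, hb, (((hc.contract _).contract _).mul _).mulGen _, hb₀, ?_⟩
  have key : ∀ w : List Letter, (.X, 0) ∉ w → diff (mulGen (.X, 0) R) w = f w := by
    intro w hw
    by_cases hAB : (.TX, 0) ∈ w ∧ (.one, 0) ∈ w
    · obtain ⟨u, hu⟩ := perm_cons_cons (by simp) hAB.1 hAB.2
      have hXu : (.X, 0) ∉ u := fun hm => hw (hu.mem_iff.2 (by simp [hm]))
      refine hb.diff.eq_of_perm hf hu.symm ?_
      have h₁ : ((u.count (.TX, 0) : K) + 1) ≠ 0 := Nat.cast_add_one_ne_zero _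
      have h₂ : ((u.count (.one, 0) : K) + 1) ≠ 0 := Nat.cast_add_one_ne_zero _
      rw [diff_of_vanish hb hb₀ hXu, mulGen_cons_self hR, List.count_eq_zero.2 hXu]
      simp only [R, p, if_neg hXu]
      field_simp
      simp
    · rw [h w hw hAB, (onlyPair_of_vanish hb₀).diff_eq_zero (fun l hl h => hw (h ▸ hl)) hAB]
  -- The difference is closed and vanishes on words without `X`. Then `diff_of_vanish` kills it on
  -- words with one `X`, and skew-symmetry on words with several, `X` being even.
  have hg : IsSkew fun w => f w - diff (mulGen (.X, 0) R) w := hf.sub hb.diff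
  have hg₀ : ∀ w : List Letter, (.X, 0) ∉ w → f w - diff (mulGen (.X, 0) R) w = 0 :=
    fun w hw => sub_eq_zero.2 (key w hw).symm
  have hgd : ∀ w, diff (fun w => f w - diff (mulGen (.X, 0) R) w) w = 0 := fun w => by
    rw [diff_sub, hd, diff_diff hb, sub_zero]
  intro w
  by_cases hw : (.X, 0) ∈ w
  · obtain ⟨u, hu⟩ : ∃ u, w.Perm ((.X, 0) :: u) := ⟨_, List.perm_cons_erase hw⟩
    refine (sub_eq_zero.1 (hg.eq_zero_of_perm hu.symm ?_)).symm
    by_cases hXu : (.X, 0) ∈ u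
    · refine hg.eq_zero_of_count (a := (.X, 0)) rfl ?_
      rw [List.count_cons_self]
      have := List.count_pos_iff.2 hXu
      omega
    · have h₁ : ((u.count (.TX, 0) : K) + 1) ≠ 0 := Nat.cast_add_one_ne_zero _
      have h₂ : ((u.count (.one, 0) : K) + 1) ≠ 0 := Nat.cast_add_one_ne_zero _
      have e := diff_of_vanish hg hg₀ hXu
      rw [hgd] at e
      simpa [h₁, h₂] using e.symm
  · exact key w hw

end Pairs

/-! ### Words of degree zero modulo the acyclic ideal. -/

section TorusWords

variable {K : Type*} [Field K]

/-- Two odd letters of opposite degrees whose bracket is `r xX + s T`. -/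
structure IsRootPair (a b : Letter) (r s : K) : Prop where
  odd_left : a.odd = true
  odd_right : b.odd = true
  ne : a ≠ b
  br_left : ∀ φ : Letter → K, br a a φ = 0
  br_right : ∀ φ : Letter → K, br b b φ = 0
  br_eq : ∀ φ : Letter → K, br a b φ = r * φ (.X, 1) + s * φ (.T, 0)
  degE : degE a + degE b = 0
  degH : degH a + degH b = 0
  degH_ne : OddContact.degH a ≠ 0

theorem isRootPair_zero : IsRootPair (K := K) (.TX, 1) (.one, 0) 2 0 := by
  refine ⟨rfl, rfl, by simp, ?_, ?_, ?_, ?_, ?_, ?_⟩ <;> simp [br, degE, degH]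

theorem isRootPair_one : IsRootPair (K := K) (.TX, 0) (.one, 1) 1 1 := by
  refine ⟨rfl, rfl, by simp, ?_, ?_, ?_, ?_, ?_, ?_⟩ <;> simp [br, degE, degH]
  intro φ; ring

/-- The word `a b a b ⋯ a b`. -/
def pairWord (a b : Letter) : ℕ → List Letter
  | 0 => []
  | n + 1 => a :: b :: pairWord a b n

theorem length_pairWord (a b : Letter) (n : ℕ) : (pairWord a b n).length = 2 * n := by
  induction n with
  | zero => rfl
  | succ n ih => simp [pairWord, ih]; ring

theorem count_pairWord_left {a b : Letter} (h : a ≠ b) (n : ℕ) :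
    (pairWord a b n).count a = n := by
  induction n with
  | zero => rfl
  | succ n ih => rw [pairWord, List.count_cons_self, List.count_cons_of_ne h.symm, ih]

theorem count_pairWord_right {a b : Letter} (h : a ≠ b) (n : ℕ) :
    (pairWord a b n).count b = n := by
  induction n with
  | zero => rfl
  | succ n ih => rw [pairWord, List.count_cons_of_ne h, List.count_cons_self, ih]

theorem mem_pairWord {a b l : Letter} {n : ℕ} (h : l ∈ pairWord a b n) : l = a ∨ l = b := by
  induction n with
  | zero => simp [pairWord] at h
  | succ n ih =>
    rcases List.mem_cons.1 h with h | h
    · exact Or.inl h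
    · rcases List.mem_cons.1 h with h | h
      · exact Or.inr h
      · exact ih h

theorem count_pairWord_of_ne {a b l : Letter} (ha : l ≠ a) (hb : l ≠ b) (n : ℕ) :
    (pairWord a b n).count l = 0 :=
  List.count_eq_zero.2 fun h => (mem_pairWord h).elim ha hb

theorem wordDegree_pairWord {ν : Letter → ℤ} {a b : Letter} (h : ν a + ν b = 0) (n : ℕ) :
    wordDegree ν (pairWord a b n) = 0 := by
  induction n with
  | zero => rfl
  | succ n ih => rw [pairWord, wordDegree_cons, wordDegree_cons, ih]; omega

namespace IsRootPair

variable {a b : Letter} {r s : K} {f : List Letter → K}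

theorem ne_of_even (h : IsRootPair a b r s) {t : Letter} (ht : t.odd = false) :
    t ≠ a ∧ t ≠ b :=
  ⟨fun e => Bool.false_ne_true (ht.symm.trans (e ▸ h.odd_left)),
    fun e => Bool.false_ne_true (ht.symm.trans (e ▸ h.odd_right))⟩

theorem diff_pairWord (h : IsRootPair a b r s) (hf : IsSkew f) (n : ℕ) :
    diff f (pairWord a b (n + 1)) = -((n + 1) ^ 2 *
      (r * f ((.X, 1) :: pairWord a b n) + s * f ((.T, 0) :: pairWord a b n))) := by
  have hP : OnlyPair (fun l => l = a ∨ l = b) a b f := by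
    rintro i j (rfl | rfl) (rfl | rfl) h₁ h₂ u v - -
    · exact h.br_left _
    · exact absurd ⟨rfl, rfl⟩ h₁
    · exact absurd ⟨rfl, rfl⟩ h₂
    · exact h.br_right _
  rw [pairWord, hP.diff_cons_cons hf h.odd_left h.odd_right h.ne (Or.inl rfl) (Or.inr rfl)
    fun l hl => mem_pairWord hl, h.br_eq, count_pairWord_left h.ne, count_pairWord_right h.ne]
  ring

/-- In degree zero contraction with `T` anticommutes with the differential, so `diff_pairWord`
applies to the contracted cochain; its `T` term drops out since `T` is even and would occur twice.
-/
theorem diff_H_pairWord (h : IsRootPair a b r s) [CharZero K] (hf : IsSkew f) (n : ℕ) :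
    diff f ((.T, 0) :: pairWord a b (n + 1)) = (n + 1) ^ 2 * r *
      f ((.T, 0) :: (.X, 1) :: pairWord a b n) := by
  have e : f ((.T, 0) :: (.T, 0) :: pairWord a b n) = 0 :=
    hf.eq_zero_of_count (a := (.T, 0)) rfl (by simp)
  rw [diff_torus_cons isTorusLetter_H f (wordDegree_pairWord h.degH _),
    h.diff_pairWord (hf.contract _), e]
  ring

theorem apply_E_H (h : IsRootPair a b r s) [CharZero K] (hr : r ≠ 0) (hf : IsSkew f)
    (hd : ∀ w, diff f w = 0) (n : ℕ) : f ((.X, 1) :: (.T, 0) :: pairWord a b n) = 0 := by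
  have e := h.diff_H_pairWord hf n
  have hn : ((n : K) + 1) ≠ 0 := Nat.cast_add_one_ne_zero _
  rw [hd, eq_comm, mul_eq_zero] at e
  rw [hf.head, e.resolve_left (mul_ne_zero (pow_ne_zero 2 hn) hr), mul_zero]

theorem apply_E_add_H (h : IsRootPair a b r s) [CharZero K] (hf : IsSkew f)
    (hd : ∀ w, diff f w = 0) (n : ℕ) :
    r * f ((.X, 1) :: pairWord a b n) + s * f ((.T, 0) :: pairWord a b n) = 0 := by
  have e := h.diff_pairWord hf n
  have hn : ((n : K) + 1) ≠ 0 := Nat.cast_add_one_ne_zero _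
  rw [hd, eq_comm, neg_eq_zero, mul_eq_zero] at e
  exact e.resolve_left (pow_ne_zero 2 hn)

/-- Even letters occur at most once and degree zero forces `a` and `b` to occur equally often, so up
to order only the four listed types of words remain. -/
theorem eq_zero (h : IsRootPair a b r s) [CharZero K] (hf : IsSkew f)
    (h₀ : ∀ n, f (pairWord a b n) = 0) (hE : ∀ n, f ((.X, 1) :: pairWord a b n) = 0)
    (hH : ∀ n, f ((.T, 0) :: pairWord a b n) = 0)
    (hEH : ∀ n, f ((.X, 1) :: (.T, 0) :: pairWord a b n) = 0)
    {w : List Letter} (hw : ∀ l ∈ w, l = (.X, 1) ∨ l = (.T, 0) ∨ l = a ∨ l = b)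
    (hdeg : wordDegree OddContact.degH w = 0) : f w = 0 := by
  have hE' := h.ne_of_even (t := (.X, 1)) rfl
  have hH' := h.ne_of_even (t := (.T, 0)) rfl
  have hcount : w.count a = w.count b := by
    have key : wordDegree OddContact.degH w = OddContact.degH a * (w.count a - w.count b) := by
      clear hdeg
      induction w with
      | nil => simp [wordDegree]
      | cons j w ih =>
        obtain ⟨hj, hw⟩ := List.forall_mem_cons.1 hw
        rw [wordDegree_cons, ih hw]
        have hd := h.degH
        rcases hj with rfl | rfl | rfl | rfl
        · rw [List.count_cons_of_ne hE'.1, List.count_cons_of_ne hE'.2]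
          simp [OddContact.degH]
        · rw [List.count_cons_of_ne hH'.1, List.count_cons_of_ne hH'.2]
          simp [OddContact.degH]
        · rw [List.count_cons_self, List.count_cons_of_ne h.ne]
          push_cast; ring
        · rw [List.count_cons_self, List.count_cons_of_ne h.ne.symm]
          push_cast
          linear_combination hd
    rw [hdeg, eq_comm, mul_eq_zero] at key
    have := key.resolve_left h.degH_ne
    omega
  by_cases h₂ : 2 ≤ w.count (.X, 1)
  · exact hf.eq_zero_of_count rfl h₂
  by_cases h₃ : 2 ≤ w.count (.T, 0)
  · exact hf.eq_zero_of_count rfl h₃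
  have hperm : ∀ v : List Letter, (∀ l ∈ v, l = (.X, 1) ∨ l = (.T, 0) ∨ l = a ∨ l = b) →
      v.count (.X, 1) = w.count (.X, 1) → v.count (.T, 0) = w.count (.T, 0) →
      v.count a = w.count a → v.count b = w.count b → v.Perm w := by
    intro v hv e₁ e₂ e₃ e₄
    refine List.perm_iff_count.2 fun l => ?_
    by_cases hl : l = (.X, 1) ∨ l = (.T, 0) ∨ l = a ∨ l = b
    · rcases hl with rfl | rfl | rfl | rfl <;> assumption
    · rw [List.count_eq_zero.2 fun h => hl (hv l h), List.count_eq_zero.2 fun h => hl (hw l h)]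
  have hp : ∀ l ∈ pairWord a b (w.count a), l = (.X, 1) ∨ l = (.T, 0) ∨ l = a ∨ l = b :=
    fun l hl => Or.inr (Or.inr (mem_pairWord hl))
  obtain ⟨n, hn⟩ : ∃ n, w.count a = n := ⟨_, rfl⟩
  rw [hn] at hcount hp
  have c₁ := count_pairWord_left h.ne n
  have c₂ := count_pairWord_right h.ne n
  have c₃ := count_pairWord_of_ne hE'.1 hE'.2 n
  have c₄ := count_pairWord_of_ne hH'.1 hH'.2 n
  have n₁ : w.count (.X, 1) = 0 ∨ w.count (.X, 1) = 1 := by omega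
  have n₂ : w.count (.T, 0) = 0 ∨ w.count (.T, 0) = 1 := by omega
  rcases n₁ with n₁ | n₁ <;> rcases n₂ with n₂ | n₂
  · refine hf.eq_zero_of_perm (hperm _ hp ?_ ?_ ?_ ?_) (h₀ n) <;> omega
  · refine hf.eq_zero_of_perm (hperm _ (List.forall_mem_cons.2 ⟨by simp, hp⟩) ?_ ?_ ?_ ?_)
      (hH n) <;>
      simp [hH'.1, hH'.2, c₁, c₂, c₃, c₄, n₁, n₂, hn, ← hcount]
  · refine hf.eq_zero_of_perm (hperm _ (List.forall_mem_cons.2 ⟨by simp, hp⟩) ?_ ?_ ?_ ?_)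
      (hE n) <;>
      simp [hE'.1, hE'.2, c₁, c₂, c₃, c₄, n₁, n₂, hn, ← hcount]
  · refine hf.eq_zero_of_perm (hperm _ (List.forall_mem_cons.2 ⟨by simp,
      List.forall_mem_cons.2 ⟨by simp, hp⟩⟩) ?_ ?_ ?_ ?_) (hEH n) <;>
      simp [hE'.1, hE'.2, hH'.1, hH'.2, c₁, c₂, c₃, c₄, n₁, n₂, hn, ← hcount]

end IsRootPair

theorem eq_zero_of_wordDegree_eq_zero {ν : Letter → ℤ} {w : List Letter}
    (h : ∀ l ∈ w, 0 ≤ ν l) (hw : wordDegree ν w = 0) : ∀ l ∈ w, ν l = 0 := by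
  have h0 : ∀ w : List Letter, (∀ l ∈ w, 0 ≤ ν l) → 0 ≤ wordDegree ν w := fun w hw =>
    List.sum_nonneg fun x hx => by
      obtain ⟨l, hl, rfl⟩ := List.mem_map.1 hx
      exact hw l hl
  induction w with
  | nil => simp
  | cons j w ih =>
    obtain ⟨hj, h⟩ := List.forall_mem_cons.1 h
    rw [wordDegree_cons] at hw
    have := h0 w h
    exact List.forall_mem_cons.2 ⟨by omega, ih h (by omega)⟩

/-- The words of degree zero on which a cochain in the ideal of `exists_primitive` vanishes. -/
theorem letters_of_degree_zero {w : List Letter} (hE : wordDegree degE w = 0)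
    (hH : wordDegree degH w = 0) (hX : (.X, 0) ∉ w) (h : ¬ ((.TX, 0) ∈ w ∧ (.one, 0) ∈ w)) :
    (∀ l ∈ w, l = (.X, 1) ∨ l = (.T, 0) ∨ l = (.TX, 1) ∨ l = (.one, 0)) ∨
      ∀ l ∈ w, l = (.X, 1) ∨ l = (.T, 0) ∨ l = (.TX, 0) ∨ l = (.one, 1) := by
  by_cases hA : (.TX, 0) ∈ w
  · right
    have hB : (.one, 0) ∉ w := fun hB => h ⟨hA, hB⟩
    -- The only letters with `degE + degH < 0` are `1` and `X`, both absent here, so every letter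
    -- has sum zero.
    have hs : wordDegree (fun l => degE l + degH l) w = 0 := by
      simp only [wordDegree, List.sum_map_add] at hE hH ⊢
      omega
    have hl := eq_zero_of_wordDegree_eq_zero ?_ hs
    · rintro ⟨m, n⟩ hm
      have := hl _ hm
      cases m <;> simp [degE, degH] at this ⊢ <;> omega
    · rintro ⟨m, n⟩ hm
      cases m <;> rcases n with _ | n <;> simp [degE, degH] <;>
        first | omega | exact absurd hm hB | exact absurd hm hX
  · left
    -- The only letters with `degE < 0` are `TX` and `X`, both absent here.
    have hl := eq_zero_of_wordDegree_eq_zero ?_ hE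
    · rintro ⟨m, n⟩ hm
      have := hl _ hm
      cases m <;> simp [degE] at this ⊢ <;> omega
    · rintro ⟨m, n⟩ hm
      cases m <;> rcases n with _ | n <;> simp [degE] <;>
        first | omega | exact absurd hm hA | exact absurd hm hX

/-- A cocycle of degree zero is a coboundary if it vanishes on the words that consist of torus
letters and pairs of opposite odd letters. -/
theorem exists_primitive_of_torus_words [CharZero K] {f : List Letter → K} (hf : IsSkew f)
    (hc : IsContinuousOnWords f) (hd : ∀ w, diff f w = 0) (hE : IsInvariant degE f)
    (hH : IsInvariant degH f)
    (h₀ : ∀ n, f (pairWord (.TX, 1) (.one, 0) n) = 0)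
    (h₁ : ∀ n, f (pairWord (.TX, 0) (.one, 1) n) = 0)
    (h₀H : ∀ n, f ((.T, 0) :: pairWord (.TX, 1) (.one, 0) n) = 0)
    (h₁H : ∀ n, f ((.T, 0) :: pairWord (.TX, 0) (.one, 1) n) = 0) :
    ∃ b : List Letter → K, IsSkew b ∧ IsContinuousOnWords b ∧
      (∀ w, (.X, 0) ∉ w → b w = 0) ∧ ∀ w, diff b w = f w := by
  have hr₀ := isRootPair_zero (K := K)
  have hr₁ := isRootPair_one (K := K)
  refine exists_primitive hf hc hd fun w hX hAB => ?_
  by_cases hwE : wordDegree degE w = 0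
  swap
  · exact hE w hwE
  by_cases hwH : wordDegree degH w = 0
  swap
  · exact hH w hwH
  rcases letters_of_degree_zero hwE hwH hX hAB with hw | hw
  · refine hr₀.eq_zero hf h₀ (fun n => ?_) h₀H (hr₀.apply_E_H two_ne_zero hf hd) hw hwH
    simpa [h₀H] using hr₀.apply_E_add_H hf hd n
  · refine hr₁.eq_zero hf h₁ (fun n => ?_) h₁H (hr₁.apply_E_H one_ne_zero hf hd) hw hwH
    simpa [h₁H] using hr₁.apply_E_add_H hf hd n

end TorusWords

/-! ### Cohomology of the complex of functions of words. -/

section WordCohomology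

variable {K : Type*} [Field K] [CharZero K]

/-- The coordinate of the third cohomology, for functions of words. -/
def thirdCoord (f : List Letter → K) : K :=
  f [(.T, 0), (.TX, 0), (.one, 1)] - 1 / 2 * f [(.T, 0), (.TX, 1), (.one, 0)]

/-- It suffices to match `f` with a coboundary on the pair words, with and without `T`: closedness
settles the words containing `xX`, and the acyclic ideal the rest. -/
theorem exists_primitive_of_eq {f b : List Letter → K} (hf : IsSkew f)
    (hc : IsContinuousOnWords f) (hd : ∀ w, diff f w = 0) (hE : IsInvariant degE f)
    (hH : IsInvariant degH f) (hb : IsSkew b) (hbc : IsContinuousOnWords b)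
    (hbE : IsInvariant degE b) (hbH : IsInvariant degH b) (hnil : f [] = 0)
    (h₀ : ∀ n, f (pairWord (.TX, 1) (.one, 0) (n + 1)) =
      diff b (pairWord (.TX, 1) (.one, 0) (n + 1)))
    (h₁ : ∀ n, f (pairWord (.TX, 0) (.one, 1) (n + 1)) =
      diff b (pairWord (.TX, 0) (.one, 1) (n + 1)))
    (h₀H : ∀ n, f ((.T, 0) :: pairWord (.TX, 1) (.one, 0) (n + 1)) =
      diff b ((.T, 0) :: pairWord (.TX, 1) (.one, 0) (n + 1)))
    (h₁H : ∀ n, f ((.T, 0) :: pairWord (.TX, 0) (.one, 1) (n + 1)) =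
      diff b ((.T, 0) :: pairWord (.TX, 0) (.one, 1) (n + 1))) :
    ∃ b : List Letter → K, IsSkew b ∧ IsContinuousOnWords b ∧ ∀ w, diff b w = f w := by
  have hg : IsSkew fun w => f w - diff b w := hf.sub hb.diff
  have hgd : ∀ w, diff (fun w => f w - diff b w) w = 0 := fun w => by
    rw [diff_sub, hd, diff_diff hb, sub_zero]
  -- For `g = f - db`, the two pairs give `2 g(xX) = 0` and `g(xX) + g(T) = 0`.
  have e : f [(.T, 0)] - diff b [(.T, 0)] = 0 := by
    have e₀ := isRootPair_zero.apply_E_add_H hg hgd 0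
    have e₁ := isRootPair_one.apply_E_add_H hg hgd 0
    simp only [pairWord] at e₀ e₁
    linear_combination e₁ - 1 / 2 * e₀
  obtain ⟨b', hb', hc', -, hd'⟩ := exists_primitive_of_torus_words hg (hc.sub hbc.diff) hgd
    (fun w hw => by rw [hE w hw, hbE.diff isGrading_degE w hw, sub_zero])
    (fun w hw => by rw [hH w hw, hbH.diff isGrading_degH w hw, sub_zero])
    (fun n => n.casesOn (by simp [pairWord, hnil, diff]) fun n => sub_eq_zero.2 (h₀ n))
    (fun n => n.casesOn (by simp [pairWord, hnil, diff]) fun n => sub_eq_zero.2 (h₁ n))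
    (fun n => n.casesOn e fun n => sub_eq_zero.2 (h₀H n))
    (fun n => n.casesOn e fun n => sub_eq_zero.2 (h₁H n))
  exact ⟨fun w => b w + b' w, hb.add hb', hbc.add hc', fun w => by rw [diff_add, hd']; ring⟩

/-- A cochain of degree zero that is dual to a word of degree zero. -/
theorem exists_invariant_dual {u : List Letter}
    (hu : ∀ a ∈ u, a.odd = false → u.count a ≤ 1) (hE : wordDegree degE u = 0)
    (hH : wordDegree degH u = 0) :
    ∃ f : List Letter → K, IsSkew f ∧ IsContinuousOnWords f ∧ IsInvariant degE f ∧
      IsInvariant degH f ∧ f u = 1 ∧ ∀ w : List Letter, ¬ w.Perm u → f w = 0 := by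
  obtain ⟨f, hf, hc, h₁, h₀⟩ := exists_dual (K := K) hu
  exact ⟨f, hf, hc, fun w hw => h₀ w fun h => hw ((wordDegree_perm _ h).trans hE),
    fun w hw => h₀ w fun h => hw ((wordDegree_perm _ h).trans hH), h₁, h₀⟩

namespace IsRootPair

variable {a b : Letter} {r s : K}

theorem exists_dual_one (h : IsRootPair a b r s) {t : Letter}
    (htE : OddContact.degE t = 0) (htH : OddContact.degH t = 0) (n : ℕ) :
    ∃ f : List Letter → K, IsSkew f ∧ IsContinuousOnWords f ∧ IsInvariant OddContact.degE f ∧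
      IsInvariant OddContact.degH f ∧ f (t :: pairWord a b n) = 1 ∧
      ∀ w : List Letter, ¬ w.Perm (t :: pairWord a b n) → f w = 0 := by
  refine exists_invariant_dual (fun c hc ho => ?_)
    (by rw [wordDegree_cons, wordDegree_pairWord h.degE, htE]; rfl)
    (by rw [wordDegree_cons, wordDegree_pairWord h.degH, htH]; rfl)
  have := h.ne_of_even ho
  rw [List.count_cons, count_pairWord_of_ne this.1 this.2]
  split <;> simp

theorem exists_dual_two (h : IsRootPair a b r s) (n : ℕ) :
    ∃ f : List Letter → K, IsSkew f ∧ IsContinuousOnWords f ∧ IsInvariant OddContact.degE f ∧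
      IsInvariant OddContact.degH f ∧ f ((.T, 0) :: (.X, 1) :: pairWord a b n) = 1 ∧
      ∀ w : List Letter, ¬ w.Perm ((.T, 0) :: (.X, 1) :: pairWord a b n) → f w = 0 := by
  refine exists_invariant_dual (fun c hc ho => ?_)
    (by rw [wordDegree_cons, wordDegree_cons, wordDegree_pairWord h.degE]; rfl)
    (by rw [wordDegree_cons, wordDegree_cons, wordDegree_pairWord h.degH]; rfl)
  have := h.ne_of_even ho
  rw [List.count_cons, List.count_cons, count_pairWord_of_ne this.1 this.2]
  by_cases hT : (.T, 0) = c
  · subst hT; simp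
  · simp only [beq_iff_eq, hT, if_false]
    split <;> simp

end IsRootPair

theorem not_perm_of_mem {u v : List Letter} (l : Letter) (hu : l ∈ u) (hv : l ∉ v) :
    ¬ u.Perm v := fun h => hv (h.mem_iff.1 hu)

/-- In the Koszul picture, degree `2(m + 1)` contains `u^(m+1)` and `v^(m+1)`, which are the
differentials of combinations of `ε u^m` and `η v^m`. -/
theorem exists_primitive_even {m : ℕ} {f : List Letter → K} (hf : IsSkew f)
    (hc : IsContinuousOnWords f) (hd : ∀ w, diff f w = 0) (hE : IsInvariant degE f)
    (hH : IsInvariant degH f) (hl : ∀ w : List Letter, w.length ≠ 2 * (m + 1) → f w = 0) :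
    ∃ b : List Letter → K, IsSkew b ∧ IsContinuousOnWords b ∧ ∀ w, diff b w = f w := by
  have hr₀ := isRootPair_zero (K := K)
  have hr₁ := isRootPair_one (K := K)
  obtain ⟨p, hp, hpc, hpE, hpH, hp₁, hp₀⟩ := hr₀.exists_dual_one (t := (.X, 1)) rfl rfl m
  obtain ⟨q, hq, hqc, hqE, hqH, hq₁, hq₀⟩ := hr₁.exists_dual_one (t := (.T, 0)) rfl rfl m
  have hm : ((m : K) + 1) ≠ 0 := Nat.cast_add_one_ne_zero _
  set x : K := -f (pairWord (.TX, 1) (.one, 0) (m + 1)) / (2 * (m + 1) ^ 2) with hx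
  -- For `m = 0` both pair words are empty, so `p` also contributes on the second pair; the last
  -- term compensates this.
  set y : K := -f (pairWord (.TX, 0) (.one, 1) (m + 1)) / (m + 1) ^ 2
    - x * p ((.X, 1) :: pairWord (.TX, 0) (.one, 1) m) with hy
  have hs : IsSkew fun w => x * p w + y * q w := (hp.mul x).add (hq.mul y)
  have hbl : ∀ w : List Letter, w.length ≠ 2 * m + 1 → x * p w + y * q w = 0 := fun w hw => by
    rw [hp₀ w fun h => hw (by simp [h.length_eq, length_pairWord]),
      hq₀ w fun h => hw (by simp [h.length_eq, length_pairWord])]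
    simp
  have hbd : ∀ w : List Letter, w.length ≠ 2 * (m + 1) →
      f w = diff (fun w => x * p w + y * q w) w := fun w hw => by
    rw [hl w hw, diff_eq_zero_of_length fun u hu => hbl u fun h => hw (by omega)]
  refine exists_primitive_of_eq hf hc hd hE hH hs
    ((hpc.mul fun _ => x).add (hqc.mul fun _ => y)) ((hpE.mul x).add (hqE.mul y))
    ((hpH.mul x).add (hqH.mul y)) (hl _ (by simp)) (fun n => ?_) (fun n => ?_)
    (fun n => hbd _ (by simp [length_pairWord]; omega))
    (fun n => hbd _ (by simp [length_pairWord]; omega))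
  · by_cases hn : n = m
    · subst hn
      rw [hr₀.diff_pairWord hs, hp₁, hq₀ _ (not_perm_of_mem (.X, 1) (by simp) (by
        simp only [List.mem_cons, not_or]
        exact ⟨by simp, fun h => by simpa using mem_pairWord h⟩)), hx]
      field_simp
      ring
    · exact hbd _ (by simp [length_pairWord, hn])
  · by_cases hn : n = m
    · subst hn
      rw [hr₁.diff_pairWord hs, hq₁, hq₀ _ (not_perm_of_mem (.X, 1) (by simp) (by
        simp only [List.mem_cons, not_or]
        exact ⟨by simp, fun h => by simpa using mem_pairWord h⟩)),
        hp₀ ((.T, 0) :: _) (not_perm_of_mem (.T, 0) (by simp) (by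
        simp only [List.mem_cons, not_or]
        exact ⟨by simp, fun h => by simpa using mem_pairWord h⟩)), hy]
      field_simp
      ring
    · exact hbd _ (by simp [length_pairWord, hn])

/-- The available primitives are dual to `T, xX` followed by one of the two pair words. They are
independent for `m > 0` but coincide for `m = 0`, so in degree three one coefficient must match two
values; `thirdCoord` is the obstruction. -/
theorem exists_primitive_odd {m : ℕ} {f : List Letter → K} (hf : IsSkew f)
    (hc : IsContinuousOnWords f) (hd : ∀ w, diff f w = 0) (hE : IsInvariant degE f)
    (hH : IsInvariant degH f) (hl : ∀ w : List Letter, w.length ≠ 2 * (m + 1) + 1 → f w = 0)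
    (h₃ : m = 0 → thirdCoord f = 0) :
    ∃ b : List Letter → K, IsSkew b ∧ IsContinuousOnWords b ∧ ∀ w, diff b w = f w := by
  have hr₀ := isRootPair_zero (K := K)
  have hr₁ := isRootPair_one (K := K)
  obtain ⟨p, hp, hpc, hpE, hpH, hp₁, hp₀⟩ := hr₀.exists_dual_two m
  obtain ⟨q, hq, hqc, hqE, hqH, hq₁, hq₀⟩ := hr₁.exists_dual_two m
  have hm : ((m : K) + 1) ≠ 0 := Nat.cast_add_one_ne_zero _
  set x : K := f ((.T, 0) :: pairWord (.TX, 1) (.one, 0) (m + 1)) / (2 * (m + 1) ^ 2) with hx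
  -- For `m = 0` the cochain `q` is dual to the same word as `p` and is not needed.
  set y : K := if m = 0 then 0 else
    f ((.T, 0) :: pairWord (.TX, 0) (.one, 1) (m + 1)) / (m + 1) ^ 2 with hy
  have hs : IsSkew fun w => x * p w + y * q w := (hp.mul x).add (hq.mul y)
  have hbl : ∀ w : List Letter, w.length ≠ 2 * (m + 1) → x * p w + y * q w = 0 := fun w hw => by
    rw [hp₀ w fun h => hw (by simp [h.length_eq, length_pairWord]; ring),
      hq₀ w fun h => hw (by simp [h.length_eq, length_pairWord]; ring)]
    simp
  have hbd : ∀ w : List Letter, w.length ≠ 2 * (m + 1) + 1 →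
      f w = diff (fun w => x * p w + y * q w) w := fun w hw => by
    rw [hl w hw, diff_eq_zero_of_length fun u hu => hbl u fun h => hw (by omega)]
  refine exists_primitive_of_eq hf hc hd hE hH hs
    ((hpc.mul fun _ => x).add (hqc.mul fun _ => y)) ((hpE.mul x).add (hqE.mul y))
    ((hpH.mul x).add (hqH.mul y)) (hl _ (by simp))
    (fun n => hbd _ (by simp [length_pairWord]; omega))
    (fun n => hbd _ (by simp [length_pairWord]; omega)) (fun n => ?_) (fun n => ?_)
  · by_cases hn : n = m
    · subst hn
      have hyq : y * q ((.T, 0) :: (.X, 1) :: pairWord (.TX, 1) (.one, 0) n) = 0 := by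
        rcases n with _ | n
        · simp [hy]
        · rw [hq₀ _ (not_perm_of_mem (.TX, 1) (by simp [pairWord]) (by
            simp only [List.mem_cons, not_or]
            exact ⟨by simp, by simp, fun h => by simpa using mem_pairWord h⟩)), mul_zero]
      rw [hr₀.diff_H_pairWord hs, hyq, hp₁, hx]
      field_simp
      ring
    · exact hbd _ (by simp [length_pairWord, hn])
  · by_cases hn : n = m
    · subst hn
      rw [hr₁.diff_H_pairWord hs, hq₁]
      rcases n with _ | n
      · have h := h₃ rfl
        simp only [thirdCoord] at h
        simp only [pairWord] at hp₁ hx ⊢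
        rw [hp₁, hx, hy]
        simp
        linear_combination h
      · rw [hp₀ _ (not_perm_of_mem (.TX, 0) (by simp [pairWord]) (by
            simp only [List.mem_cons, not_or]
            exact ⟨by simp, by simp, fun h => by simpa using mem_pairWord h⟩)), hy,
          if_neg (by simp)]
        field_simp
        ring
    · exact hbd _ (by simp [length_pairWord, hn])

/-- A cocycle of positive degree is a coboundary, if in degree three its coordinate vanishes. -/
theorem exists_primitive_of_cocycle {k : ℕ} (hk : 1 ≤ k) {f : List Letter → K} (hf : IsSkew f)
    (hc : IsContinuousOnWords f) (hd : ∀ w, diff f w = 0)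
    (hl : ∀ w : List Letter, w.length ≠ k → f w = 0) (h₃ : k = 3 → thirdCoord f = 0) :
    ∃ b : List Letter → K, IsSkew b ∧ IsContinuousOnWords b ∧ ∀ w, diff b w = f w := by
  obtain ⟨b₁, hb₁, hc₁, e₁⟩ := exists_invariant isTorusLetter_E isGrading_degE hf hc hd
  have hg := hf.sub hb₁.diff
  have hgc := hc.sub hc₁.diff
  have hgd : ∀ w, diff (fun w => f w - diff b₁ w) w = 0 := fun w => by
    rw [diff_sub, hd, diff_diff hb₁, sub_zero]
  obtain ⟨b₂, hb₂, hc₂, e₂⟩ := exists_invariant isTorusLetter_H isGrading_degH hg hgc hgd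
  have hh := hg.sub hb₂.diff
  have hhc := hgc.sub hc₂.diff
  have hhd : ∀ w, diff (fun w => f w - diff b₁ w - diff b₂ w) w = 0 := fun w => by
    rw [diff_sub, hgd, diff_diff hb₂, sub_zero]
  have e : ∀ w, f w - diff b₁ w - diff b₂ w =
      if wordDegree degH w = 0 then if wordDegree degE w = 0 then f w else 0 else 0 := fun w => by
    rw [e₂, e₁]
  have hE : IsInvariant degE fun w => f w - diff b₁ w - diff b₂ w := fun w hw => by
    simp only [e, if_neg hw, ite_self]
  have hH : IsInvariant degH fun w => f w - diff b₁ w - diff b₂ w := fun w hw => by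
    simp only [e, if_neg hw]
  have hhl : ∀ w : List Letter, w.length ≠ k → f w - diff b₁ w - diff b₂ w = 0 := fun w hw => by
    rw [e, hl w hw, ite_self, ite_self]
  obtain ⟨b, hb, hbc, hbd⟩ : ∃ b : List Letter → K, IsSkew b ∧ IsContinuousOnWords b ∧
      ∀ w, diff b w = f w - diff b₁ w - diff b₂ w := by
    rcases Nat.even_or_odd' k with ⟨n, rfl | rfl⟩
    · obtain ⟨m, rfl⟩ : ∃ m, n = m + 1 := ⟨n - 1, by omega⟩
      exact exists_primitive_even hh hhc hhd hE hH hhl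
    · rcases n with _ | m
      · refine exists_primitive_of_eq hh hhc hhd hE hH isSkew_zero .zero
          (fun _ _ => rfl) (fun _ _ => rfl) (hhl _ (by simp)) (fun n => ?_) (fun n => ?_)
          (fun n => ?_) (fun n => ?_) <;>
          rw [diff_zero] <;> exact hhl _ (by simp [length_pairWord]; try omega)
      · refine exists_primitive_odd hh hhc hhd hE hH hhl fun hm => ?_
        subst hm
        have h := h₃ rfl
        simp only [thirdCoord] at h ⊢
        -- Both words in `thirdCoord` have degree zero, so passing to the invariant part preserves
        -- the coordinate.
        simp only [e]
        simpa [wordDegree, degE, degH] using h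
  exact ⟨fun w => b w + (b₁ w + b₂ w), hb.add (hb₁.add hb₂), hbc.add (hc₁.add hc₂), fun w => by
    rw [diff_add, diff_add, hbd]; ring⟩

/-- On the two words in `thirdCoord` a coboundary takes the values `b(T, xX)` and `2 b(T, xX)`,
according to the coefficients of `xX` in `[TX, x]` and `[xTX, 1]`; hence the factor `1 / 2`. -/
theorem thirdCoord_diff {b : List Letter → K} (hb : IsSkew b) : thirdCoord (diff b) = 0 := by
  have e₀ := isRootPair_zero.diff_H_pairWord hb 0
  have e₁ := isRootPair_one.diff_H_pairWord hb 0
  simp only [pairWord] at e₀ e₁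
  rw [thirdCoord, e₀, e₁]
  simp

/-- A cocycle that represents the generator of the third cohomology. -/
theorem exists_third_cocycle :
    ∃ f : List Letter → K, IsSkew f ∧ IsContinuousOnWords f ∧ (∀ w, diff f w = 0) ∧
      thirdCoord f = 1 := by
  have hr₀ := isRootPair_zero (K := K)
  have hr₁ := isRootPair_one (K := K)
  obtain ⟨p, hp, hpc, hpE, hpH, hp₁, hp₀⟩ := hr₁.exists_dual_one (t := (.T, 0)) rfl rfl 1
  obtain ⟨q, hq, hqc, hqE, hqH, hq₁, hq₀⟩ := hr₁.exists_dual_one (t := (.X, 1)) rfl rfl 1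
  have hs : IsSkew fun w => p w - q w := hp.sub hq
  have hE : IsInvariant degE fun w => p w - q w := fun w hw => by
    simp only [hpE w hw, hqE w hw, sub_zero]
  have hH : IsInvariant degH fun w => p w - q w := fun w hw => by
    simp only [hpH w hw, hqH w hw, sub_zero]
  have hl : ∀ w : List Letter, w.length ≠ 3 → p w - q w = 0 := fun w hw => by
    rw [hp₀ w fun h => hw h.length_eq, hq₀ w fun h => hw h.length_eq, sub_zero]
  have hdl : ∀ w : List Letter, w.length ≠ 4 → diff (fun w => p w - q w) w = 0 := fun w hw =>
    diff_eq_zero_of_length fun u hu => hl u fun h => hw (by omega)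
  have hp₂ : ∀ w : List Letter, (.T, 0) ∉ w → p w = 0 := fun w hw =>
    hp₀ w fun h => hw (h.mem_iff.2 (by simp))
  have hq₂ : ∀ w : List Letter, (.X, 1) ∉ w → q w = 0 := fun w hw =>
    hq₀ w fun h => hw (h.mem_iff.2 (by simp))
  have hp₃ : ∀ w : List Letter, (.TX, 0) ∉ w → p w = 0 := fun w hw =>
    hp₀ w fun h => hw (h.mem_iff.2 (by simp [pairWord]))
  have hq₃ : ∀ w : List Letter, (.TX, 0) ∉ w → q w = 0 := fun w hw =>
    hq₀ w fun h => hw (h.mem_iff.2 (by simp [pairWord]))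
  -- The cochain `p - q` represents `(η - ε)v`. Its differential lies in the acyclic ideal, so it
  -- has a primitive `j` there. Subtracting `j` gives a cocycle, and the coordinate is unaffected
  -- since `j` vanishes on words without `X`.
  obtain ⟨j, hj, hjc, hjX, hjd⟩ := exists_primitive_of_torus_words hs.diff (hpc.sub hqc).diff
    (diff_diff hs) (hE.diff isGrading_degE) (hH.diff isGrading_degH)
    (fun n => by
      by_cases hn : n = 2
      · subst hn
        rw [hr₀.diff_pairWord hs, hp₃, hq₃, hp₃, hq₃] <;> simp [pairWord]
      · exact hdl _ (by rw [length_pairWord]; omega))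
    (fun n => by
      by_cases hn : n = 2
      · subst hn
        rw [hr₁.diff_pairWord hs, hp₁, hq₁, hp₂, hq₂] <;> simp [pairWord]
      · exact hdl _ (by rw [length_pairWord]; omega))
    (fun n => hdl _ (by rw [List.length_cons, length_pairWord]; omega))
    (fun n => hdl _ (by rw [List.length_cons, length_pairWord]; omega))
  refine ⟨fun w => p w - q w - j w, hs.sub hj, (hpc.sub hqc).sub hjc, fun w => ?_, ?_⟩
  · rw [diff_sub, hjd, sub_self]
  · simp only [pairWord] at hp₁
    simp only [thirdCoord]
    rw [hjX, hjX, hp₁, hq₂, hp₃, hq₃] <;> simp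

end WordCohomology

/-! ### The bracket on monomials and its `x`-adic continuity. -/

section Bracket

variable {K : Type*} [Field K]

theorem mul_add (f g h : M1 K) : mul f (g + h) = mul f g + mul f h := by
  funext m; cases m <;> simp only [mul, Pi.add_apply] <;> ring

theorem add_mul (f g h : M1 K) : mul (f + g) h = mul f h + mul g h := by
  funext m; cases m <;> simp only [mul, Pi.add_apply] <;> ring

theorem mul_smul (r : K) (f g : M1 K) : mul f (r • g) = r • mul f g := by
  funext m; cases m <;> simp only [mul, Pi.smul_apply, mul_smul_comm, smul_add, smul_sub]

theorem smul_mul (r : K) (f g : M1 K) : mul (r • f) g = r • mul f g := by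
  funext m; cases m <;> simp only [mul, Pi.smul_apply, smul_mul_assoc, smul_add, smul_sub]

theorem dx_add (f g : M1 K) : dx (f + g) = dx f + dx g := by
  funext m; simp [dx]

theorem dx_smul (r : K) (f : M1 K) : dx (r • f) = r • dx f := by
  funext m; simp [dx]

theorem dT_add (f g : M1 K) : dT (f + g) = dT f + dT g := by
  funext m; cases m <;> simp [dT]

theorem dT_smul (r : K) (f : M1 K) : dT (r • f) = r • dT f := by
  funext m; cases m <;> simp [dT]

theorem dX_add (f g : M1 K) : dX (f + g) = dX f + dX g := by
  funext m; cases m <;> simp [dX, add_comm]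

theorem dX_smul (r : K) (f : M1 K) : dX (r • f) = r • dX f := by
  funext m; cases m <;> simp [dX]

theorem signed_add (f g : M1 K) : signed (f + g) = signed f + signed g := by
  funext m; cases m <;> simp [signed, add_comm]

theorem signed_smul (r : K) (f : M1 K) : signed (r • f) = r • signed f := by
  funext m; cases m <;> simp [signed]

theorem delta_add (f g : M1 K) : delta (f + g) = delta f + delta g := by
  simp only [delta, euler, dx_add, dX_add, mul_add, smul_add]; abel

theorem delta_smul (r : K) (f : M1 K) : delta (r • f) = r • delta f := by
  simp only [delta, euler, dx_smul, dX_smul, mul_smul, smul_add, smul_sub, smul_comm r (2 : K) f]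

theorem bracket_add (f g h : M1 K) : bracket f (g + h) = bracket f g + bracket f h := by
  simp only [bracket, buttin, delta_add, dT_add, dX_add, dx_add, mul_add]; abel

theorem add_bracket (f g h : M1 K) : bracket (f + g) h = bracket f h + bracket g h := by
  simp only [bracket, buttin, delta_add, dT_add, dX_add, dx_add, signed_add, add_mul]; abel

theorem bracket_smul (r : K) (f g : M1 K) : bracket f (r • g) = r • bracket f g := by
  simp only [bracket, buttin, delta_smul, dT_smul, dX_smul, dx_smul, mul_smul, smul_add, smul_sub]

theorem smul_bracket (r : K) (f g : M1 K) : bracket (r • f) g = r • bracket f g := by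
  simp only [bracket, buttin, delta_smul, dT_smul, dX_smul, dx_smul, signed_smul, smul_mul,
    smul_add, smul_sub]

theorem dx_mono (m : GMon) (n : ℕ) : dx (mono K m n) = (n : K) • mono K m (n - 1) := by
  funext l
  by_cases h : l = m
  · subst h
    simp [dx, mono, PowerSeries.smul_eq_C_mul]
  · simp [dx, mono, h]

theorem dT_mono (m : GMon) (n : ℕ) : dT (mono K m n) =
    match m with
    | .T => mono K .one n
    | .TX => mono K .X n
    | _ => 0 := by
  funext l; cases m <;> cases l <;> simp [dT, mono]

theorem dX_mono (m : GMon) (n : ℕ) : dX (mono K m n) =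
    match m with
    | .X => mono K .one n
    | .TX => (-1 : K) • mono K .T n
    | _ => 0 := by
  funext l; cases m <;> cases l <;> simp [dX, mono]

theorem signed_mono (m : GMon) (n : ℕ) : signed (mono K m n) =
    match m with
    | .T => (-1 : K) • mono K .T n
    | .X => (-1 : K) • mono K .X n
    | m => mono K m n := by
  funext l; cases m <;> cases l <;> simp [signed, mono]

theorem mul_mono (m n : GMon) (a b : ℕ) : mul (mono K m a) (mono K n b) =
    match m, n with
    | .one, n => mono K n (a + b)
    | m, .one => mono K m (a + b)
    | .T, .X => mono K .TX (a + b)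
    | .X, .T => (-1 : K) • mono K .TX (a + b)
    | _, _ => 0 := by
  funext l; cases m <;> cases n <;> cases l <;> simp [mul, mono, pow_add]

theorem zero_mul' (f : M1 K) : mul 0 f = 0 := by
  simpa using smul_mul (0 : K) f f

theorem mul_zero' (f : M1 K) : mul f 0 = 0 := by
  simpa using mul_smul (0 : K) f f

theorem delta_mono (m : GMon) (n : ℕ) : delta (mono K m n) =
    match m with
    | .one => (2 - n : K) • mono K .one n
    | .T => (2 - n : K) • mono K .T n
    | .X => (1 - n : K) • mono K .X n
    | .TX => (1 - n : K) • mono K .TX n := by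
  have h : ∀ m, (n : K) • mono K m (1 + (n - 1)) = (n : K) • mono K m n := fun m => by
    rcases n with _ | n
    · simp
    · rw [Nat.add_sub_cancel, add_comm]
  cases m <;>
    simp only [delta, euler, dx_mono, dX_mono, mul_smul, mul_mono, mul_zero', zero_add, h] <;>
    module

theorem natCast_smul_mono (m : GMon) (a b : ℕ) :
    (a : K) • mono K m (a - 1 + b) = (a : K) • mono K m (a + b - 1) := by
  rcases a with _ | a
  · simp
  · rw [Nat.add_sub_cancel, Nat.add_right_comm, Nat.add_sub_cancel]

theorem natCast_smul_mono' (m : GMon) (a b : ℕ) :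
    (b : K) • mono K m (a + (b - 1)) = (b : K) • mono K m (a + b - 1) := by
  rw [add_comm a, natCast_smul_mono, add_comm a]

/-- This ties the table `br` to the bracket. Pairing with a linear form is enough, as a cochain is
linear in the argument that holds the bracket. -/
theorem map_bracket_mono (φ : M1 K →ₗ[K] K) (i j : Letter) :
    φ (bracket (mono K i.1 i.2) (mono K j.1 j.2)) = br i j (fun k => φ (mono K k.1 k.2)) := by
  obtain ⟨m, a⟩ := i
  obtain ⟨n, b⟩ := j
  have h₁ : ∀ m, (a : K) * φ (mono K m (a - 1 + b)) = a * φ (mono K m (a + b - 1)) := fun m => by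
    simpa using congrArg φ (natCast_smul_mono (K := K) m a b)
  have h₂ : ∀ m, (b : K) * φ (mono K m (a + (b - 1))) = b * φ (mono K m (a + b - 1)) := fun m => by
    simpa using congrArg φ (natCast_smul_mono' (K := K) m a b)
  cases m <;> cases n <;>
    simp only [br, bracket, buttin, delta_mono, dT_mono, dX_mono, dx_mono, signed_mono, dX_smul,
      dT_smul, mul_smul, smul_mul, mul_mono, mul_zero', zero_mul', map_add, map_sub, map_smul,
      map_zero, smul_eq_mul, smul_zero, h₁]
  case X.one => linear_combination h₂ .one
  case X.T | TX.one => linear_combination h₂ .T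
  case X.X => linear_combination h₂ .X
  case X.TX => linear_combination h₂ .TX - h₁ .TX
  case TX.X => linear_combination h₂ .TX
  all_goals ring

theorem mono_mem_part (i : Letter) : mono K i.1 i.2 ∈ part K (i.1.parity + 1) := by
  intro m hm
  have : m ≠ i.1 := by
    rintro rfl
    apply hm
    rw [add_assoc, show (1 : ZMod 2) + 1 = 0 from rfl, add_zero]
  simp [mono, this]

theorem sg_eq_pow (i j : Letter) :
    (sg i j : K) = (-1) ^ ((i.1.parity + 1).val * (j.1.parity + 1).val) := by
  have h₀ : ((0 : ZMod 2) + 1).val = 1 := rfl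
  have h₁ : ((1 : ZMod 2) + 1).val = 0 := rfl
  obtain ⟨m, a⟩ := i
  obtain ⟨n, b⟩ := j
  cases m <;> cases n <;> simp only [sg, Letter.odd, GMon.parity, h₀, h₁] <;> simp

/-- All coefficients of `f` are divisible by `x^N`. -/
def XDvd (N : ℕ) (f : M1 K) : Prop := ∀ m : GMon, (PowerSeries.X ^ N : PowerSeries K) ∣ f m

theorem XDvd.add {N : ℕ} {f g : M1 K} (hf : XDvd N f) (hg : XDvd N g) : XDvd N (f + g) :=
  fun m => dvd_add (hf m) (hg m)

theorem XDvd.sub {N : ℕ} {f g : M1 K} (hf : XDvd N f) (hg : XDvd N g) : XDvd N (f - g) :=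
  fun m => dvd_sub (hf m) (hg m)

theorem XDvd.mul_left {N : ℕ} {f : M1 K} (hf : XDvd N f) (g : M1 K) : XDvd N (mul f g) := by
  intro m
  cases m <;> simp only [mul]
  · exact (hf _).mul_right _
  · exact dvd_add ((hf _).mul_right _) ((hf _).mul_right _)
  · exact dvd_add ((hf _).mul_right _) ((hf _).mul_right _)
  · exact dvd_sub (dvd_add (dvd_add ((hf _).mul_right _) ((hf _).mul_right _))
      ((hf _).mul_right _)) ((hf _).mul_right _)

theorem XDvd.mul_right {N : ℕ} {f : M1 K} (hf : XDvd N f) (g : M1 K) : XDvd N (mul g f) := by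
  intro m
  cases m <;> simp only [mul]
  · exact (hf _).mul_left _
  · exact dvd_add ((hf _).mul_left _) ((hf _).mul_left _)
  · exact dvd_add ((hf _).mul_left _) ((hf _).mul_left _)
  · exact dvd_sub (dvd_add (dvd_add ((hf _).mul_left _) ((hf _).mul_left _))
      ((hf _).mul_left _)) ((hf _).mul_left _)

theorem XDvd.mono {N M : ℕ} (h : N ≤ M) {f : M1 K} (hf : XDvd M f) : XDvd N f :=
  fun m => (pow_dvd_pow _ h).trans (hf m)

theorem XDvd.dx {N : ℕ} {f : M1 K} (hf : XDvd (N + 1) f) : XDvd N (dx f) := by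
  intro m
  obtain ⟨g, hg⟩ := hf m
  simp only [OddContact.dx, hg, Derivation.leibniz, PowerSeries.derivative_pow, smul_eq_mul]
  refine dvd_add ?_ ?_
  · exact (pow_dvd_pow _ (Nat.le_succ N)).mul_right _
  · refine Dvd.dvd.mul_left ?_ _
    simp only [Nat.add_sub_cancel]
    exact ((dvd_refl _).mul_left _).mul_right _

theorem XDvd.dT {N : ℕ} {f : M1 K} (hf : XDvd N f) : XDvd N (dT f) := by
  intro m
  cases m <;> simp only [OddContact.dT]
  exacts [hf _, dvd_zero _, hf _, dvd_zero _]

theorem XDvd.dX {N : ℕ} {f : M1 K} (hf : XDvd N f) : XDvd N (dX f) := by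
  intro m
  cases m <;> simp only [OddContact.dX]
  exacts [hf _, (dvd_neg).2 (hf _), dvd_zero _, dvd_zero _]

theorem XDvd.signed {N : ℕ} {f : M1 K} (hf : XDvd N f) : XDvd N (signed f) := by
  intro m
  cases m <;> simp only [OddContact.signed]
  exacts [hf _, (dvd_neg).2 (hf _), (dvd_neg).2 (hf _), hf _]

theorem XDvd.delta {N : ℕ} {f : M1 K} (hf : XDvd (N + 1) f) : XDvd N (delta f) := by
  have hf' := hf.mono (Nat.le_succ N)
  refine XDvd.sub (fun m => ?_) ((hf.dx.mul_right _).add (hf'.dX.mul_right _))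
  rw [Pi.smul_apply, PowerSeries.smul_eq_C_mul]
  exact (hf' m).mul_left _

theorem XDvd.bracket_left {N : ℕ} {f : M1 K} (hf : XDvd (N + 1) f) (g : M1 K) :
    XDvd N (bracket f g) := by
  have hf' := hf.mono (Nat.le_succ N)
  exact ((hf.delta.mul_left _).add (hf'.signed.dT.mul_left _)).sub
    ((hf.dx.mul_left _).add (hf'.signed.dX.mul_left _))

theorem XDvd.bracket_right {N : ℕ} {f : M1 K} (hf : XDvd (N + 1) f) (g : M1 K) :
    XDvd N (bracket g f) := by
  have hf' := hf.mono (Nat.le_succ N)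
  exact ((hf'.dT.mul_right _).add (hf.delta.mul_right _)).sub
    ((hf'.dX.mul_right _).add (hf.dx.mul_right _))

end Bracket

/-! ### Continuous multilinear maps and their values on monomials. -/

section Multilinear

variable {K : Type*} [Field K]

/-- Splitting off `N` leading terms leaves a multiple of `x^N`, which continuity kills. The
predicate `P` singles out the Grassmann components allowed in a homogeneous argument. -/
theorem linear_eq_zero {P : GMon → Prop} {φ : M1 K →ₗ[K] K} {N : ℕ}
    (hN : ∀ f, XDvd N f → φ f = 0) (hm : ∀ m n, P m → φ (mono K m n) = 0) {f : M1 K}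
    (hf : ∀ m, ¬ P m → f m = 0) : φ f = 0 := by
  have key : ∀ (m : GMon) (p : PowerSeries K), P m → φ (Pi.single m p) = 0 := by
    intro m p hP
    have step : ∀ n : ℕ, ∃ q : PowerSeries K,
        φ (Pi.single m p) = φ (Pi.single m (PowerSeries.X ^ n * q)) := by
      intro n
      induction n with
      | zero => exact ⟨p, by simp⟩
      | succ n ih =>
        obtain ⟨q, hq⟩ := ih
        refine ⟨PowerSeries.mk fun p => PowerSeries.coeff (p + 1) q, ?_⟩
        have e : (Pi.single m (PowerSeries.X ^ n * q) : M1 K) =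
            PowerSeries.constantCoeff q • mono K m n + Pi.single m (PowerSeries.X ^ (n + 1) *
              PowerSeries.mk fun p => PowerSeries.coeff (p + 1) q) := by
          rw [mono, ← Pi.single_smul, ← Pi.single_add, PowerSeries.smul_eq_C_mul]
          congr 1
          conv_lhs => rw [PowerSeries.eq_X_mul_shift_add_const q]
          ring
        rw [hq, e, map_add, map_smul, hm m n hP, smul_zero, zero_add]
    obtain ⟨q, hq⟩ := step N
    rw [hq]
    refine hN _ fun l => ?_
    by_cases h : l = m
    · subst h; simp
    · simp [h]
  have e : f = Pi.single .one (f .one) + Pi.single .T (f .T) + Pi.single .X (f .X)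
      + Pi.single .TX (f .TX) := by
    funext m; cases m <;> simp
  have h0 : ∀ m, φ (Pi.single m (f m)) = 0 := fun m => by
    by_cases h : P m
    · exact key m _ h
    · rw [hf m h, Pi.single_zero, map_zero]
  rw [e, map_add, map_add, map_add, h0, h0, h0, h0]
  simp

/-- The basis element of `M(1)` given by a letter. -/
noncomputable abbrev Letter.toM1 (K : Type*) [Field K] (i : Letter) : M1 K := mono K i.1 i.2

/-- A continuous multilinear map is determined by its values on monomials. -/
theorem multilinear_eq_zero {k : ℕ} {Φ : MultilinearMap K (fun _ : Fin k => M1 K) K}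
    (hΦ : IsAdicContinuous Φ) {P : Fin k → GMon → Prop}
    (h : ∀ w : Fin k → Letter, (∀ i, P i (w i).1) → Φ (fun i => (w i).toM1 K) = 0)
    {v : Fin k → M1 K} (hv : ∀ i m, ¬ P i m → v i m = 0) : Φ v = 0 := by
  obtain ⟨N, hN⟩ := hΦ
  -- `S` contains the arguments not yet known to be monomials; they are replaced one at a time.
  have key : ∀ (S : Finset (Fin k)) (v : Fin k → M1 K), (∀ i m, ¬ P i m → v i m = 0) →
      (∀ i, i ∉ S → ∃ l : Letter, P i l.1 ∧ v i = l.toM1 K) → Φ v = 0 := by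
    intro S
    induction S using Finset.induction_on with
    | empty =>
      intro v _ hv
      choose w hw using fun i => hv i (by simp)
      rw [show v = fun i => (w i).toM1 K from funext fun i => (hw i).2]
      exact h w fun i => (hw i).1
    | insert i S hi ih =>
      intro v hv hS
      have := linear_eq_zero (P := P i) (φ := Φ.toLinearMap v i) (N := N) (fun f hf =>
        hN _ i (by simpa [XDvd] using hf)) (fun m n hP => ih _ ?_ ?_) (hv i)
      · simpa using this
      · intro j l hl
        by_cases hj : j = i
        · subst hj
          have : l ≠ m := by rintro rfl; exact hl hP
          simp [mono, this]
        · rw [Function.update_of_ne hj]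
          exact hv j l hl
      · intro j hj
        by_cases hji : j = i
        · subst hji
          exact ⟨(m, n), hP, by simp⟩
        · rw [Function.update_of_ne hji]
          exact hS j (by simp [hji, hj])
  exact key Finset.univ v hv (by simp)

/-- Once each term of `dValue` is known to be multilinear and continuous, an identity `D = dc` can
be checked on monomials alone. -/
theorem exists_term_multilinear {k : ℕ} (c : MultilinearMap K (fun _ : Fin k => M1 K) K)
    {i j : Fin (k + 1)} (hij : i ≠ j) :
    ∃ D : MultilinearMap K (fun _ : Fin (k + 1) => M1 K) K,
      (∀ v, D v = c (j.removeNth (Function.update v i (bracket (v i) (v j))))) ∧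
      (IsAdicContinuous c → IsAdicContinuous D) := by
  obtain ⟨i, rfl⟩ := Fin.exists_succAbove_eq hij
  have e : ∀ v : Fin (k + 1) → M1 K, j.removeNth (Function.update v (j.succAbove i)
      (bracket (v (j.succAbove i)) (v j))) =
      Function.update (j.removeNth v) i (bracket (v (j.succAbove i)) (v j)) := fun v =>
    Fin.removeNth_update_succAbove j i _ v
  have e₁ : ∀ (v : Fin (k + 1) → M1 K) (x : M1 K), j.removeNth (Function.update v j x) =
      j.removeNth v := fun v x => Fin.removeNth_update j x v
  have e₂ : ∀ (v : Fin (k + 1) → M1 K) (m : Fin k) (x : M1 K),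
      j.removeNth (Function.update v (j.succAbove m) x) =
      Function.update (j.removeNth v) m x := fun v m x => Fin.removeNth_update_succAbove j m x v
  have e₃ : ∀ (v : Fin (k + 1) → M1 K) (m : Fin k) (x : M1 K),
      Function.update v (j.succAbove m) x j = v j := fun v m x =>
    Function.update_of_ne (Fin.succAbove_ne j m).symm x v
  have e₄ : ∀ (v : Fin (k + 1) → M1 K) {m : Fin k}, m ≠ i → ∀ x : M1 K,
      Function.update v (j.succAbove m) x (j.succAbove i) = v (j.succAbove i) := fun v m hm x =>
    Function.update_of_ne (fun h => hm (Fin.succAbove_right_injective h).symm) x v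
  refine ⟨⟨fun v => c (Function.update (j.removeNth v) i (bracket (v (j.succAbove i)) (v j))),
    ?_, ?_⟩, fun v => by rw [e]; rfl, ?_⟩
  · intro inst v m x y
    rw [Subsingleton.elim inst (instDecidableEqFin _)]
    rcases Fin.eq_self_or_eq_succAbove j m with rfl | ⟨m, rfl⟩
    · simp [e₁, bracket_add]
    · by_cases hm : m = i
      · subst hm
        simp [e₂, add_bracket]
      · simp only [e₂, e₃, e₄ v hm, Function.update_comm hm, MultilinearMap.map_update_add]
  · intro inst v m x y
    rw [Subsingleton.elim inst (instDecidableEqFin _)]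
    rcases Fin.eq_self_or_eq_succAbove j m with rfl | ⟨m, rfl⟩
    · simp [e₁, bracket_smul]
    · by_cases hm : m = i
      · subst hm
        simp [e₂, smul_bracket]
      · simp only [e₂, e₃, e₄ v hm, Function.update_comm hm, MultilinearMap.map_update_smul]
  · rintro ⟨N, hN⟩
    refine ⟨N + 1, fun v m hv => ?_⟩
    change c (Function.update (j.removeNth v) i (bracket (v (j.succAbove i)) (v j))) = 0
    rcases Fin.eq_self_or_eq_succAbove j m with rfl | ⟨m, rfl⟩
    · refine hN _ i ?_
      rw [Function.update_self]
      exact XDvd.bracket_right hv _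
    · by_cases hm : m = i
      · subst hm
        refine hN _ m ?_
        rw [Function.update_self]
        exact XDvd.bracket_left hv _
      · refine hN _ m ?_
        rw [Function.update_of_ne hm]
        exact XDvd.mono (Nat.le_succ N) hv

theorem isAdicContinuous_zero {k : ℕ} :
    IsAdicContinuous (0 : MultilinearMap K (fun _ : Fin k => M1 K) K) := ⟨0, fun _ _ _ => rfl⟩

theorem IsAdicContinuous.add {k : ℕ} {c c' : MultilinearMap K (fun _ : Fin k => M1 K) K}
    (hc : IsAdicContinuous c) (hc' : IsAdicContinuous c') : IsAdicContinuous (c + c') := by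
  obtain ⟨N, hN⟩ := hc
  obtain ⟨M, hM⟩ := hc'
  refine ⟨max N M, fun v i hv => ?_⟩
  rw [add_apply, hN v i (XDvd.mono (le_max_left N M) hv),
    hM v i (XDvd.mono (le_max_right N M) hv), add_zero]

theorem IsAdicContinuous.smul {k : ℕ} {c : MultilinearMap K (fun _ : Fin k => M1 K) K}
    (hc : IsAdicContinuous c) (r : K) : IsAdicContinuous (r • c) := by
  obtain ⟨N, hN⟩ := hc
  exact ⟨N, fun v i hv => by rw [smul_apply, hN v i hv, smul_zero]⟩

theorem IsAdicContinuous.sum {k : ℕ} {ι : Type*} {S : Finset ι}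
    {c : ι → MultilinearMap K (fun _ : Fin k => M1 K) K} (hc : ∀ i ∈ S, IsAdicContinuous (c i)) :
    IsAdicContinuous (∑ i ∈ S, c i) :=
  Finset.sum_induction c IsAdicContinuous (fun _ _ => .add) isAdicContinuous_zero hc

theorem exists_dValue_multilinear {k : ℕ} (c : MultilinearMap K (fun _ : Fin k => M1 K) K)
    (s : Fin (k + 1) → ZMod 2) :
    ∃ D : MultilinearMap K (fun _ : Fin (k + 1) => M1 K) K,
      (∀ v, D v = dValue c s v) ∧ (IsAdicContinuous c → IsAdicContinuous D) := by
  have h : ∀ i j : Fin (k + 1), ∃ D : MultilinearMap K (fun _ : Fin (k + 1) => M1 K) K,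
      i ≠ j → (∀ v, D v = c (j.removeNth (Function.update v i (bracket (v i) (v j))))) ∧
      (IsAdicContinuous c → IsAdicContinuous D) := fun i j => by
    by_cases hij : i = j
    · exact ⟨0, fun h => absurd hij h⟩
    · obtain ⟨D, hD⟩ := exists_term_multilinear c hij
      exact ⟨D, fun _ => hD⟩
  choose D hD using h
  refine ⟨∑ i : Fin (k + 1), ∑ j ∈ Finset.Ioi i,
    ((-1) ^ ((j : ℕ) + (s j).val * ∑ m ∈ Finset.Ioo i j, (s m).val) : K) • D i j, fun v => ?_,
    fun hc => .sum fun i _ => .sum fun j hj => .smul ((hD i j ?_).2 hc) _⟩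
  · simp only [sum_apply, smul_apply, smul_eq_mul, dValue]
    refine Finset.sum_congr rfl fun i _ => Finset.sum_congr rfl fun j hj => ?_
    rw [(hD i j (Finset.mem_Ioi.1 hj).ne).1]
  · exact (Finset.mem_Ioi.1 hj).ne

end Multilinear

/-! ### Translation between multilinear cochains and functions of words. -/

section Comparison

variable {K : Type*} [Field K]

/-- The function `f` of words describes the values of `c` on monomials. -/
def Describes {k : ℕ} (f : List Letter → K)
    (c : MultilinearMap K (fun _ : Fin k => M1 K) K) : Prop :=
  ∀ w : Fin k → Letter, c (fun i => (w i).toM1 K) = f (List.ofFn w)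

theorem cons_toM1 {k : ℕ} (i : Letter) (w : Fin k → Letter) :
    (Fin.cons (i.toM1 K) fun j => (w j).toM1 K : Fin (k + 1) → M1 K) =
      fun j => ((Fin.cons i w : Fin (k + 1) → Letter) j).toM1 K := by
  funext j
  refine Fin.cases ?_ (fun j => ?_) j <;> simp

theorem Describes.curryLeft {k : ℕ} {f : List Letter → K}
    {c : MultilinearMap K (fun _ : Fin (k + 1) => M1 K) K} (h : Describes f c) (i : Letter) :
    Describes (fun u => f (i :: u)) (c.curryLeft (i.toM1 K)) := by
  intro w
  rw [MultilinearMap.curryLeft_apply, cons_toM1, h, List.ofFn_cons]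

theorem removeNth_succ_cons {α : Type*} {k : ℕ} (j : Fin (k + 1)) (x : α) (v : Fin (k + 1) → α) :
    j.succ.removeNth (Fin.cons x v : Fin (k + 2) → α) = Fin.cons x (j.removeNth v) := by
  funext m
  refine Fin.cases ?_ (fun m => ?_) m
  · simp [Fin.removeNth]
  · simp [Fin.removeNth, Fin.succ_succAbove_succ]

theorem pow_parity_val (i j : Letter) (n : ℕ) :
    (-1 : K) ^ ((i.1.parity + 1).val * ((j.1.parity + 1).val + n)) =
      sg i j * (-1) ^ ((i.1.parity + 1).val * n) := by
  rw [Nat.mul_add, pow_add, sg_eq_pow]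

/-- The left side collects the terms of the differential that involve the first argument. There the
bracket stays in front while `lie` inserts it in place; the signs come from moving it past the
letters between. -/
theorem sum_bracket_eq_lie {k : ℕ} {f : List Letter → K} (hf : IsSkew f) (i : Letter)
    (w : Fin (k + 1) → Letter) :
    ∑ j : Fin (k + 1), (-1) ^ ((j : ℕ) + 1 +
      ((w j).1.parity + 1).val * ∑ m ∈ Finset.Iio j, ((w m).1.parity + 1).val) *
        br i (w j) (fun l => f (l :: List.ofFn (j.removeNth w))) = lie i f (List.ofFn w) := by
  induction k generalizing f with
  | zero =>
    have e : Finset.Iio (0 : Fin 1) = ∅ := rfl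
    simp [lie, e]
  | succ k ih =>
    obtain ⟨a, w, rfl⟩ : ∃ a u, w = Fin.cons a u := ⟨w 0, Fin.tail w, (Fin.cons_self_tail w).symm⟩
    have e : Finset.Iio (0 : Fin (k + 2)) = ∅ := by ext; simp
    rw [List.ofFn_cons, lie, ← ih (hf.contract a), Fin.sum_univ_succ,
      Finset.mul_sum Finset.univ _ (sg i a)]
    congr 1
    · rw [Fin.removeNth_zero, Fin.tail_cons, e, Fin.cons_zero]
      simp
    · refine Finset.sum_congr rfl fun j _ => ?_
      have e : Finset.Iio j.succ =
          Finset.cons 0 ((Finset.Iio j).map (Fin.succEmb _)) (by simp) := by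
        ext m
        refine Fin.cases (by simp) (fun m => by simp) m
      rw [e, Finset.sum_cons, Finset.sum_map, removeNth_succ_cons, List.ofFn_cons,
        br_cons_comm hf]
      simp only [Fin.cons_zero, Fin.cons_succ, Fin.coe_succEmb, Fin.val_succ]
      rw [pow_add, pow_parity_val, pow_add _ (_ + 1 : ℕ), pow_succ]
      linear_combination (-1) ^ ((j : ℕ) + 1) * sg i a *
        (-1) ^ (((w j).1.parity + 1).val * ∑ m ∈ Finset.Iio j, ((w m).1.parity + 1).val) *
        br i (w j) (fun l => f (a :: l :: List.ofFn (j.removeNth w))) *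
        sg_mul_self (K := K) (w j) a

/-- Cartan's formula for the explicit differential: the pairs with `i = 0` are split off, and the
shift of `j` by one produces the minus sign of the remainder. -/
theorem dValue_cons {k : ℕ} (c : MultilinearMap K (fun _ : Fin (k + 1) => M1 K) K)
    (s : Fin (k + 2) → ZMod 2) (x : M1 K) (v : Fin (k + 1) → M1 K) :
    dValue c s (Fin.cons x v) =
      ∑ j : Fin (k + 1), (-1) ^ ((j : ℕ) + 1 +
        (s j.succ).val * ∑ m ∈ Finset.Iio j, (s m.succ).val) *
          c (Fin.cons (bracket x (v j)) (j.removeNth v)) -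
      dValue (c.curryLeft x) (fun j => s j.succ) v := by
  rw [dValue, Fin.sum_univ_succ, sub_eq_add_neg]
  congr 1
  · rw [Fin.Ioi_zero_eq_map, Finset.sum_map]
    refine Finset.sum_congr rfl fun j _ => ?_
    rw [Fin.coe_succEmb, ← Fin.map_succEmb_Iio, Finset.sum_map, Fin.update_cons_zero,
      removeNth_succ_cons]
    simp
  · rw [dValue, ← Finset.sum_neg_distrib]
    refine Finset.sum_congr rfl fun i _ => ?_
    rw [← Fin.map_succEmb_Ioi, Finset.sum_map, ← Finset.sum_neg_distrib]
    refine Finset.sum_congr rfl fun j _ => ?_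
    rw [Fin.coe_succEmb, ← Fin.map_succEmb_Ioo, Finset.sum_map, ← Fin.cons_update,
      removeNth_succ_cons]
    simp only [Fin.val_succ, Fin.coe_succEmb, Fin.cons_succ, MultilinearMap.curryLeft_apply]
    rw [add_right_comm, pow_succ]
    ring

/-- On monomials, the differential is given by the differential of functions of words. -/
theorem dValue_eq_diff {k : ℕ} {f : List Letter → K} (hf : IsSkew f)
    {c : MultilinearMap K (fun _ : Fin k => M1 K) K} (h : Describes f c)
    (w : Fin (k + 1) → Letter) :
    dValue c (fun i => (w i).1.parity + 1) (fun i => (w i).toM1 K) = diff f (List.ofFn w) := by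
  induction k generalizing f with
  | zero => simp [dValue, diff, lie]
  | succ k ih =>
    obtain ⟨a, w, rfl⟩ : ∃ a u, w = Fin.cons a u := ⟨w 0, Fin.tail w, (Fin.cons_self_tail w).symm⟩
    rw [← cons_toM1, dValue_cons, List.ofFn_cons, diff, ← sum_bracket_eq_lie hf]
    simp only [Fin.cons_succ]
    rw [ih (hf.contract a) (h.curryLeft a)]
    congr 1
    refine Finset.sum_congr rfl fun j _ => ?_
    congr 1
    refine (map_bracket_mono (⟨⟨fun x => c (Fin.cons x (j.removeNth fun i => (w i).toM1 K)),
      fun x y => c.cons_add _ x y⟩, fun r x => c.cons_smul _ r x⟩ : M1 K →ₗ[K] K) a (w j)).trans ?_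
    congr 1
    funext l
    rw [← List.ofFn_cons, ← h, ← cons_toM1]
    rfl

theorem exists_eq_ofFn {α : Type*} {k : ℕ} {w : List α} (h : w.length = k) :
    ∃ v : Fin k → α, w = List.ofFn v := by
  subst h
  exact ⟨w.get, (List.ofFn_get w).symm⟩

/-- The values of a multilinear map on monomials, as a function of words. -/
noncomputable def toWords {k : ℕ} (c : MultilinearMap K (fun _ : Fin k => M1 K) K)
    (w : List Letter) : K :=
  if h : w.length = k then c (fun i => (w.get (i.cast h.symm)).toM1 K) else 0

theorem describes_toWords {k : ℕ} (c : MultilinearMap K (fun _ : Fin k => M1 K) K) :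
    Describes (toWords c) c := by
  intro w
  simp [toWords]

theorem toWords_of_length_ne {k : ℕ} (c : MultilinearMap K (fun _ : Fin k => M1 K) K)
    {w : List Letter} (h : w.length ≠ k) : toWords c w = 0 := dif_neg h

theorem exists_ofFn_swap {α : Type*} {k : ℕ} (w : Fin k → α) {i j : Fin k}
    (hij : (j : ℕ) = i + 1) : ∃ u t : List α, u.length = (i : ℕ) ∧
      List.ofFn w = u ++ w i :: w j :: t ∧
      List.ofFn (w ∘ Equiv.swap i j) = u ++ w j :: w i :: t := by
  refine ⟨(List.ofFn w).take i, (List.ofFn w).drop (i + 2), by simp, ?_, ?_⟩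
  · refine List.ext_getElem (by simp; omega) fun n h₁ h₂ => ?_
    simp [List.getElem_append, List.getElem_cons]
    grind
  · refine List.ext_getElem (by simp; omega) fun n h₁ h₂ => ?_
    simp [List.getElem_append, List.getElem_cons, Equiv.swap_apply_def]
    grind

theorem isSkew_toWords {k : ℕ} {c : MultilinearMap K (fun _ : Fin k => M1 K) K}
    (hc : IsSuperSkew c) : IsSkew (toWords c) := by
  intro u i j w
  by_cases h : (u ++ i :: j :: w).length = k
  · obtain ⟨v, hv⟩ := exists_eq_ofFn h
    have hp : u.length < k := by simp at h; omega
    have hq : u.length + 1 < k := by simp at h; omega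
    obtain ⟨u', w', hu, h₁, h₂⟩ := exists_ofFn_swap v (i := ⟨u.length, hp⟩)
      (j := ⟨u.length + 1, hq⟩) rfl
    obtain ⟨rfl, h₃⟩ := List.append_inj (hv.trans h₁) hu.symm
    simp only [List.cons.injEq] at h₃
    obtain ⟨rfl, rfl, rfl⟩ := h₃
    rw [← h₂, hv, ← describes_toWords c, ← describes_toWords c, sg_eq_pow]
    have := hc ⟨u.length, hp⟩ ⟨u.length + 1, hq⟩ rfl _ _ (fun i => (v i).toM1 K)
      (mono_mem_part _) (mono_mem_part _)
    rw [show (fun l => ((v ∘ Equiv.swap _ _) l).toM1 K) = (fun i => (v i).toM1 K) ∘ Equiv.swap _ _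
      from rfl, this, ← mul_assoc, neg_mul_neg, ← pow_add, ← two_mul, pow_mul, neg_one_sq, one_pow,
      one_mul]
  · rw [toWords_of_length_ne c h, toWords_of_length_ne c (by simpa using h), mul_zero]

theorem isContinuousOnWords_toWords {k : ℕ} {c : MultilinearMap K (fun _ : Fin k => M1 K) K}
    (hc : IsAdicContinuous c) : IsContinuousOnWords (toWords c) := by
  obtain ⟨N, hN⟩ := hc
  refine ⟨N, fun w ⟨l, hl, h⟩ => ?_⟩
  by_cases hk : w.length = k
  · obtain ⟨v, rfl⟩ := exists_eq_ofFn hk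
    obtain ⟨p, rfl⟩ := List.mem_ofFn.1 hl
    rw [← describes_toWords c]
    refine hN _ p fun m => ?_
    by_cases hm : m = (v p).1
    · subst hm
      simpa [mono] using pow_dvd_pow _ h
    · simp [mono, hm]
  · exact toWords_of_length_ne c hk

theorem IsAdicContinuous.domDomCongr {k : ℕ} {c : MultilinearMap K (fun _ : Fin k => M1 K) K}
    (hc : IsAdicContinuous c) (σ : Equiv.Perm (Fin k)) : IsAdicContinuous (c.domDomCongr σ) := by
  obtain ⟨N, hN⟩ := hc
  exact ⟨N, fun v i hv => hN _ (σ.symm i) fun m => by simpa using hv m⟩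

/-- Both sides of the symmetry are continuous and multilinear, so monomials of the prescribed
parities at `i` and `j` suffice. -/
theorem isSuperSkew_of_describes {k : ℕ} {f : List Letter → K} (hf : IsSkew f)
    {c : MultilinearMap K (fun _ : Fin k => M1 K) K} (hc : IsAdicContinuous c)
    (h : Describes f c) : IsSuperSkew c := by
  intro i j hij a b v hi hj
  have hne : i ≠ j := by rintro rfl; omega
  have := multilinear_eq_zero
    (Φ := c.domDomCongr (Equiv.swap i j) + ((-1) ^ (a.val * b.val) : K) • c)
    ((hc.domDomCongr _).add (hc.smul _))
    (P := fun l m => (l = i → m.parity = a + 1) ∧ (l = j → m.parity = b + 1))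
    (fun w hw => ?_) (v := v) (fun l m hm => ?_)
  · simp only [add_apply, MultilinearMap.domDomCongr_apply, smul_apply, smul_eq_mul] at this
    rw [neg_mul]
    exact eq_neg_of_add_eq_zero_left this
  · simp only [add_apply, MultilinearMap.domDomCongr_apply, smul_apply, smul_eq_mul]
    have e : ∀ {l : Letter} {s : ZMod 2}, l.1.parity = s + 1 → s = l.1.parity + 1 := fun h => by
      rw [h, add_assoc, show (1 : ZMod 2) + 1 = 0 from rfl, add_zero]
    obtain ⟨u, t, -, h₁, h₂⟩ := exists_ofFn_swap w hij
    have hs := h (w ∘ Equiv.swap i j)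
    simp only [Function.comp_apply] at hs
    rw [e ((hw i).1 rfl), e ((hw j).2 rfl), ← sg_eq_pow, h w, hs, h₁, h₂, hf u (w j) (w i), sg_comm]
    ring
  · by_cases hli : l = i
    · subst hli
      exact hi m fun hp => hm ⟨fun _ => hp, fun h => absurd h hne⟩
    · by_cases hlj : l = j
      · subst hlj
        exact hj m fun hp => hm ⟨fun h => absurd h hli, fun _ => hp⟩
      · exact absurd ⟨fun h => absurd h hli, fun h => absurd h hlj⟩ hm

/-- The coefficient of a generating function at a letter. -/
noncomputable def coord (K : Type*) [Field K] (l : Letter) : M1 K →ₗ[K] K :=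
  PowerSeries.coeff l.2 ∘ₗ LinearMap.proj l.1

theorem coord_toM1 (l i : Letter) : coord K l (i.toM1 K) = if l = i then 1 else 0 := by
  obtain ⟨m, a⟩ := l
  obtain ⟨n, b⟩ := i
  by_cases h : m = n
  · subst h
    simp [coord, mono, PowerSeries.coeff_X_pow]
  · simp [coord, mono, h]

/-- A skew continuous function of words describes a cochain. -/
theorem exists_cochain {f : List Letter → K} (hf : IsSkew f) (hc : IsContinuousOnWords f) (k : ℕ) :
    ∃ c ∈ Cochain K k, Describes f c := by
  obtain ⟨N, hN⟩ := hc
  let S : Finset Letter := ({.one, .T, .X, .TX} : Finset GMon) ×ˢ Finset.range N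
  have hS : ∀ l : Letter, l ∈ S ↔ l.2 < N := fun ⟨m, n⟩ => by cases m <;> simp [S]
  -- Continuity of `f` makes this expansion in products of coordinate forms finite: exponents from
  -- `N` on do not contribute.
  let c : MultilinearMap K (fun _ : Fin k => M1 K) K :=
    ∑ w ∈ Fintype.piFinset fun _ : Fin k => S, f (List.ofFn w) •
      (MultilinearMap.mkPiAlgebra K (Fin k) K).compLinearMap fun i => coord K (w i)
  have hcv : ∀ v, c v = ∑ w ∈ Fintype.piFinset fun _ : Fin k => S,
      f (List.ofFn w) * ∏ i, coord K (w i) (v i) := fun v => by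
    simp [c, sum_apply]
  have hd : Describes f c := fun w => by
    have e : ∀ u : Fin k → Letter,
        ∏ i, coord K (u i) ((w i).toM1 K) = if u = w then 1 else 0 := fun u => by
      split_ifs with h
      · simp [h, coord_toM1]
      · obtain ⟨i, hi⟩ := Function.ne_iff.1 h
        exact Finset.prod_eq_zero (Finset.mem_univ i) (by rw [coord_toM1, if_neg hi])
    simp only [hcv, e, mul_ite, mul_one, mul_zero, Finset.sum_ite_eq', Fintype.mem_piFinset, hS]
    split_ifs with h
    · rfl
    · push Not at h
      obtain ⟨i, hi⟩ := h
      exact (hN _ ⟨w i, List.mem_ofFn.2 ⟨i, rfl⟩, hi⟩).symm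
  have hcont : IsAdicContinuous c := by
    refine ⟨N, fun v i hv => ?_⟩
    rw [hcv]
    refine Finset.sum_eq_zero fun w hw => ?_
    rw [Finset.prod_eq_zero (Finset.mem_univ i), mul_zero]
    exact PowerSeries.X_pow_dvd_iff.1 (hv _) _ ((hS _).1 (Fintype.mem_piFinset.1 hw i))
  exact ⟨c, ⟨isSuperSkew_of_describes hf hcont hd, hcont⟩, hd⟩

theorem isDifferential_of_describes {k : ℕ} {f g : List Letter → K} (hf : IsSkew f)
    {c : MultilinearMap K (fun _ : Fin k => M1 K) K}
    {D : MultilinearMap K (fun _ : Fin (k + 1) => M1 K) K} (hc : IsAdicContinuous c)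
    (hD : IsAdicContinuous D) (hfc : Describes f c) (hgD : Describes g D)
    (h : ∀ w, diff f w = g w) : IsDifferential c D := by
  intro s v hv
  obtain ⟨D', hD', hc'⟩ := exists_dValue_multilinear c s
  have := multilinear_eq_zero (Φ := D + (-1 : K) • D') (hD.add ((hc' hc).smul _))
    (P := fun i m => m.parity = s i + 1) (fun w hw => ?_) (v := v) (fun i m hm => hv i m hm)
  · rw [← hD']
    simp at this
    linear_combination this
  · have hs : s = fun i => (w i).1.parity + 1 := funext fun i => by
      rw [hw i, add_assoc, show (1 : ZMod 2) + 1 = 0 from rfl, add_zero]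
    simp only [add_apply, smul_apply, hD', hgD w]
    rw [hs, dValue_eq_diff hf hfc, h]
    simp

theorem diff_toWords {k : ℕ} {c : MultilinearMap K (fun _ : Fin k => M1 K) K}
    (hc : IsSuperSkew c) {D : MultilinearMap K (fun _ : Fin (k + 1) => M1 K) K}
    (h : IsDifferential c D) (w : List Letter) : diff (toWords c) w = toWords D w := by
  by_cases hw : w.length = k + 1
  · obtain ⟨v, rfl⟩ := exists_eq_ofFn hw
    rw [← dValue_eq_diff (isSkew_toWords hc) (describes_toWords c), ← describes_toWords D]
    exact (h _ _ fun m => mono_mem_part _).symm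
  · rw [toWords_of_length_ne D hw, diff_eq_zero_of_length fun u hu =>
      toWords_of_length_ne c (by omega)]

end Comparison

/-! ### The cohomology groups and the coordinate `a³`. -/

section Main

variable {K : Type*} [Field K]

theorem diff_toWords_of_mem_cocycle {k : ℕ} {c : MultilinearMap K (fun _ : Fin k => M1 K) K}
    (hc : c ∈ Cocycle K k) (w : List Letter) : diff (toWords c) w = 0 := by
  rw [diff_toWords hc.1.1 hc.2, toWords]
  split_ifs <;> rfl

/-- A skew, continuous, closed function of words describes a cocycle. -/
theorem exists_cocycle {f : List Letter → K} (hf : IsSkew f) (hc : IsContinuousOnWords f)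
    (hd : ∀ w, diff f w = 0) (k : ℕ) : ∃ c ∈ Cocycle K k, Describes f c := by
  obtain ⟨c, hm, h⟩ := exists_cochain hf hc k
  exact ⟨c, ⟨hm, isDifferential_of_describes hf hm.2 isAdicContinuous_zero h (g := fun _ => 0)
    (fun _ => rfl) hd⟩, h⟩

theorem toWords_three (c : MultilinearMap K (fun _ : Fin 3 => M1 K) K) (i j l : Letter) :
    c ![mono K i.1 i.2, mono K j.1 j.2, mono K l.1 l.2] = toWords c [i, j, l] := by
  have := describes_toWords c ![i, j, l]
  simp only [List.ofFn_succ, List.ofFn_zero] at this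
  refine Eq.trans ?_ this
  congr 1
  funext m
  fin_cases m <;> rfl

/-- The coordinate `a³` on the space of cocycles of degree three. -/
noncomputable def thirdCoordHom (K : Type*) [Field K] : Cocycle K 3 →ₗ[K] K where
  toFun C := C.1 ![mono K .T 0, mono K .TX 0, mono K .one 1]
    - 1 / 2 * C.1 ![mono K .T 0, mono K .TX 1, mono K .one 0]
  map_add' C C' := by
    simp only [Submodule.coe_add, add_apply]
    ring
  map_smul' r C := by
    simp only [Submodule.coe_smul, smul_apply, smul_eq_mul, RingHom.id_apply]
    ring

theorem thirdCoordHom_apply (C : Cocycle K 3) :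
    thirdCoordHom K C = thirdCoord (toWords C.1) :=
  congrArg₂ (· - 1 / 2 * ·) (toWords_three C.1 (.T, 0) (.TX, 0) (.one, 1))
    (toWords_three C.1 (.T, 0) (.TX, 1) (.one, 0))

variable [CharZero K]

theorem mem_coboundary {k : ℕ} {c : MultilinearMap K (fun _ : Fin (k + 1) => M1 K) K}
    (hc : c ∈ Cocycle K (k + 1)) (h₃ : k + 1 = 3 → thirdCoord (toWords c) = 0) :
    c ∈ Coboundary K (k + 1) := by
  obtain ⟨b, hb, hbc, hd⟩ := exists_primitive_of_cocycle (Nat.succ_pos k)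
    (isSkew_toWords hc.1.1) (isContinuousOnWords_toWords hc.1.2) (diff_toWords_of_mem_cocycle hc)
    (fun w hw => toWords_of_length_ne c hw) h₃
  obtain ⟨β, hβ, h⟩ := exists_cochain hb hbc k
  exact ⟨hc.1, β, hβ, isDifferential_of_describes hb hβ.2 hc.1.2 h (describes_toWords c) hd⟩

theorem subsingleton_cohomology {k : ℕ} (h₁ : 1 ≤ k) (h₃ : k ≠ 3) :
    Subsingleton (Cohomology K k) := by
  obtain ⟨k, rfl⟩ := Nat.exists_eq_add_of_le' h₁
  refine Submodule.Quotient.subsingleton_iff.2 (eq_top_iff.2 fun c _ => ?_)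
  exact mem_coboundary c.2 fun h => absurd h h₃

/-- `thirdCoord_diff` gives one inclusion, and the vanishing of the only obstruction in degree three
gives the other. -/
theorem ker_thirdCoordHom :
    (Coboundary K 3).submoduleOf (Cocycle K 3) = LinearMap.ker (thirdCoordHom K) := by
  ext C
  rw [LinearMap.mem_ker, thirdCoordHom_apply]
  constructor
  · rintro ⟨-, b, hb, hd⟩
    rw [← thirdCoord_diff (isSkew_toWords hb.1)]
    exact congrArg thirdCoord (funext fun w => (diff_toWords hb.1 hd w).symm)
  · exact fun h => mem_coboundary C.2 fun _ => h

theorem thirdCoordHom_surjective : Function.Surjective (thirdCoordHom K) := by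
  obtain ⟨f, hf, hc, hd, h₁⟩ := exists_third_cocycle (K := K)
  obtain ⟨c, hm, h⟩ := exists_cocycle hf hc hd 3
  refine fun r => ⟨r • ⟨c, hm⟩, ?_⟩
  have e : ∀ i j l : Letter, toWords c [i, j, l] = f [i, j, l] := fun i j l => by
    simpa [List.ofFn_succ] using (describes_toWords c ![i, j, l]).symm.trans (h ![i, j, l])
  rw [map_smul, thirdCoordHom_apply]
  simp only [thirdCoord, e] at h₁ ⊢
  rw [h₁, smul_eq_mul, mul_one]

/-- The third cohomology is a line with the coordinate `a³`. -/
noncomputable def thirdCohomologyEquiv (K : Type*) [Field K] [CharZero K] :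
    Cohomology K 3 ≃ₗ[K] K :=
  Submodule.quotEquivOfEq _ _ ker_thirdCoordHom ≪≫ₗ
    (thirdCoordHom K).quotKerEquivOfSurjective thirdCoordHom_surjective

theorem thirdCohomologyEquiv_mk (C : Cocycle K 3) :
    thirdCohomologyEquiv K (Submodule.Quotient.mk C) = thirdCoordHom K C := rfl

/-! ### Equivalent expressions for `a³`, from closedness on particular words. -/

section Forms

variable {f : List Letter → K}

/-- Closedness on `x, x, TX, TX`, where `[x, TX] = xX + T` is the only nonzero bracket. The
identities `s1`, `s2`, … here and below only reorder arguments. -/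
theorem value_T_TX_x_eq_X (hf : IsSkew f) (hd : ∀ w, diff f w = 0) :
    f [(.T, 0), (.TX, 0), (.one, 1)] = -f [(.X, 1), (.TX, 0), (.one, 1)] := by
  have h := hd [(.one, 1), (.one, 1), (.TX, 0), (.TX, 0)]
  have s1 := hf [] (.one, 1) (.TX, 0) [(.T, 0)]
  have s2 := hf [(.TX, 0)] (.one, 1) (.T, 0) []
  have s3 := hf [] (.TX, 0) (.T, 0) [(.one, 1)]
  have s4 := hf [] (.one, 1) (.TX, 0) [(.X, 1)]
  have s5 := hf [(.TX, 0)] (.one, 1) (.X, 1) []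
  have s6 := hf [] (.TX, 0) (.X, 1) [(.one, 1)]
  have s7 := hf [] (.one, 1) (.T, 0) [(.TX, 0)]
  have s8 := hf [(.T, 0)] (.one, 1) (.TX, 0) []
  have s9 := hf [] (.one, 1) (.X, 1) [(.TX, 0)]
  have s10 := hf [(.X, 1)] (.one, 1) (.TX, 0) []
  simp [diff, lie, br, sg, Letter.odd] at h s1 s2 s3 s4 s5 s6 s7 s8 s9 s10
  grind

theorem value_T_TX_x_eq_X_xX_xT (hf : IsSkew f) (hd : ∀ w, diff f w = 0) :
    f [(.T, 0), (.TX, 0), (.one, 1)] = f [(.X, 0), (.X, 1), (.T, 1)] := by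
  rw [value_T_TX_x_eq_X hf hd]
  have h := hd [(.one, 0), (.T, 1), (.X, 1), (.TX, 0)]
  have s1 := hf [] (.one, 1) (.X, 1) [(.TX, 0)]
  have s2 := hf [(.X, 1)] (.one, 1) (.TX, 0) []
  have s3 := hf [] (.T, 1) (.X, 1) [(.X, 0)]
  have s4 := hf [(.X, 1)] (.T, 1) (.X, 0) []
  have s5 := hf [] (.X, 1) (.X, 0) [(.T, 1)]
  simp [diff, lie, br, sg, Letter.odd] at h s1 s2 s3 s4 s5
  grind

theorem value_T_TX_x_eq_X_T_xT (hf : IsSkew f) (hd : ∀ w, diff f w = 0) :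
    f [(.T, 0), (.TX, 0), (.one, 1)] = -f [(.X, 0), (.T, 0), (.T, 1)] := by
  have h := hd [(.one, 0), (.T, 0), (.T, 1), (.TX, 0)]
  have s1 := hf [(.T, 0)] (.one, 1) (.TX, 0) []
  have s2 := hf [(.T, 0)] (.T, 1) (.X, 0) []
  have s3 := hf [] (.T, 0) (.X, 0) [(.T, 1)]
  simp [diff, lie, br, sg, Letter.odd] at h s1 s2 s3
  grind

/-- Closedness on `1, x, TX, xTX` relates all the values involved. Its extra term with arguments
`xX, 1, xTX` vanishes by closedness on `1, 1, xTX, xTX`, and the one with `xX, x, TX` is rewritten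
by `value_T_TX_x_eq_X`. -/
theorem thirdCoord_eq (hf : IsSkew f) (hd : ∀ w, diff f w = 0) :
    thirdCoord f = f [(.X, 0), (.TX, 1), (.one, 1)] + 1 / 2 * f [(.X, 2), (.TX, 0), (.one, 0)]
      + 1 / 2 * f [(.T, 1), (.TX, 0), (.one, 0)] := by
  have h := value_T_TX_x_eq_X hf hd
  rw [thirdCoord]
  have h₁ := hd [(.one, 0), (.one, 0), (.TX, 1), (.TX, 1)]
  have h₂ := hd [(.one, 0), (.one, 1), (.TX, 0), (.TX, 1)]
  have s1 := hf [(.one, 0)] (.TX, 1) (.X, 1) []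
  have s2 := hf [] (.one, 1) (.TX, 0) [(.X, 1)]
  have s3 := hf [(.TX, 0)] (.one, 1) (.X, 1) []
  have s4 := hf [] (.TX, 0) (.X, 1) [(.one, 1)]
  have s5 := hf [] (.one, 1) (.X, 0) [(.TX, 1)]
  have s6 := hf [(.X, 0)] (.one, 1) (.TX, 1) []
  have s7 := hf [] (.one, 0) (.T, 0) [(.TX, 1)]
  have s8 := hf [(.T, 0)] (.one, 0) (.TX, 1) []
  have s9 := hf [] (.one, 0) (.TX, 0) [(.X, 2)]
  have s10 := hf [(.TX, 0)] (.one, 0) (.X, 2) []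
  have s11 := hf [] (.TX, 0) (.X, 2) [(.one, 0)]
  have s12 := hf [] (.one, 0) (.TX, 0) [(.T, 1)]
  have s13 := hf [(.TX, 0)] (.one, 0) (.T, 1) []
  have s14 := hf [] (.TX, 0) (.T, 1) [(.one, 0)]
  simp [diff, lie, br, sg, Letter.odd] at h₁ h₂ s1 s2 s3 s4 s5 s6 s7 s8 s9 s10 s11 s12 s13 s14
  grind

end Forms

end Main
end OddContact

theorem mainTheorem3 (K : Type*) [Field K] [CharZero K] :
    -- no cohomology in the degrees from 1 to 10 different from 3
    (∀ k : ℕ, 1 ≤ k → k ≤ 10 → k ≠ 3 → Subsingleton (OddContact.Cohomology K k)) ∧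
    -- the class of a 3-cocycle is determined by its component expression `a³`, which takes all
    -- values and vanishes exactly on the coboundaries; so the third cohomology is a line
    (∃ a : OddContact.Cohomology K 3 ≃ₗ[K] K, ∀ C : OddContact.Cocycle K 3,
      a (Submodule.Quotient.mk C) =
        C.1 ![OddContact.mono K .T 0, OddContact.mono K .TX 0, OddContact.mono K .one 1]
          - 1 / 2 * C.1 ![OddContact.mono K .T 0, OddContact.mono K .TX 1,
              OddContact.mono K .one 0]) ∧
    -- the equivalent forms of `a³`
    (∀ C ∈ OddContact.Cocycle K 3, ∀ a₃ : K,
      a₃ = C ![OddContact.mono K .T 0, OddContact.mono K .TX 0, OddContact.mono K .one 1]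
          - 1 / 2 * C ![OddContact.mono K .T 0, OddContact.mono K .TX 1,
              OddContact.mono K .one 0] →
      a₃ = C ![OddContact.mono K .X 0, OddContact.mono K .X 1, OddContact.mono K .T 1]
          - 1 / 2 * C ![OddContact.mono K .T 0, OddContact.mono K .TX 1,
              OddContact.mono K .one 0] ∧
      a₃ = - C ![OddContact.mono K .X 0, OddContact.mono K .T 0, OddContact.mono K .T 1]
          - 1 / 2 * C ![OddContact.mono K .T 0, OddContact.mono K .TX 1,
              OddContact.mono K .one 0] ∧
      a₃ = C ![OddContact.mono K .X 0, OddContact.mono K .TX 1, OddContact.mono K .one 1]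
          + 1 / 2 * C ![OddContact.mono K .X 2, OddContact.mono K .TX 0,
              OddContact.mono K .one 0]
          + 1 / 2 * C ![OddContact.mono K .T 1, OddContact.mono K .TX 0,
              OddContact.mono K .one 0] ∧
      a₃ = - C ![OddContact.mono K .X 1, OddContact.mono K .TX 0, OddContact.mono K .one 1]
          - 1 / 2 * C ![OddContact.mono K .T 0, OddContact.mono K .TX 1,
              OddContact.mono K .one 0]) := by
  refine ⟨fun k h₁ _ h₃ => OddContact.subsingleton_cohomology h₁ h₃,
    ⟨OddContact.thirdCohomologyEquiv K, OddContact.thirdCohomologyEquiv_mk⟩, ?_⟩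
  rintro C hC a₃ rfl
  have hf := OddContact.isSkew_toWords hC.1.1
  have hd := OddContact.diff_toWords_of_mem_cocycle hC
  have e := OddContact.toWords_three C
  have h := OddContact.thirdCoord_eq hf hd
  rw [OddContact.thirdCoord] at h
  simp only [← e] at h
  have h₁ := OddContact.value_T_TX_x_eq_X_xX_xT hf hd
  have h₂ := OddContact.value_T_TX_x_eq_X_T_xT hf hd
  have h₄ := OddContact.value_T_TX_x_eq_X hf hd
  simp only [← e] at h₁ h₂ h₄
  exact ⟨by rw [h₁], by rw [h₂], h, by rw [h₄]⟩
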